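/- Let $s\in(0,1)$, $q\in(0,1]$, $p\in[0,1]$ and put $\alpha:=p-q$. The minimal random walk with parameters $p,q,s$ is the process $S_n=X_1+\dots+X_n$ ($S_0=0$) with movements $X_n\in\{0,1\}$ such that $X_1$ is Bernoulli with parameter $s$ and, for every $n\ge 1$: an instant $k(n+1)$ is chosen uniformly at random in $\{1,\dots,n\}$, independently of $X_1,\dots,X_n$; and, conditionally on $X_1,\dots,X_n$ and $k(n+1)$, the movement $X_{n+1}$ is Bernoulli with parameter $p$ if $X_{k(n+1)}=1$, and with parameter $q$ if $X_{k(n+1)}=0$. Let $$\sigma^2:=\frac{q(1-p)}{(1-\alpha)^2}.$$ If $\alpha<1/2$ (the diffusive regime), then for every integer $r\ge 1$, almost surely, $$\lim_{n\to\infty}\frac{1}{\log n}\sum_{k=1}^n k^{r-1}\left(\frac{S_k}{k}-\frac{q}{1-\alpha}\right)^{2r}=\frac{\sigma^{2r}\,(2r)!}{2^r\, r!\,(1-2\alpha)^r}.$$ -/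

import Mathlib

open MeasureTheory ProbabilityTheory Filter Topology

/-- The σ-algebra generated by the movements `X 1, …, X n`
(the trivial σ-algebra when `n = 0`). -/
def mrwPast {Ω : Type*} (X : ℕ → Ω → ℝ) (n : ℕ) : MeasurableSpace Ω :=
  ⨆ i ∈ Finset.Icc 1 n, MeasurableSpace.comap (X i) inferInstance

/-- `X` is the sequence of movements of a minimal random walk with parameters `p, q, s` on the
probability space `(Ω, P)`, and `K (n + 1)` is the past instant, chosen uniformly in `{1, …, n}`,
which the walker recalls in order to make the movement `X (n + 1)`.
Only `X n` for `n ≥ 1` and `K n` for `n ≥ 2` are meaningful. -/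
structure IsMinimalRandomWalk {Ω : Type*} [MeasurableSpace Ω] (P : Measure Ω) (p q s : ℝ)
    (X : ℕ → Ω → ℝ) (K : ℕ → Ω → ℕ) : Prop where
  measurable_X : ∀ n, 1 ≤ n → Measurable (X n)
  measurable_K : ∀ n, 2 ≤ n → Measurable (K n)
  /-- every movement is `0` or `1` -/
  zero_or_one : ∀ n, 1 ≤ n → ∀ᵐ ω ∂P, X n ω = 0 ∨ X n ω = 1
  /-- the first movement is Bernoulli with parameter `s` -/
  first : P.real {ω | X 1 ω = 1} = s
  /-- given the past movements, the recalled instant is uniform on `{1, …, n}` -/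
  uniform : ∀ n, 1 ≤ n → ∀ j ∈ Finset.Icc 1 n,
    P⟦{ω | K (n + 1) ω = j} | mrwPast X n⟧ =ᵐ[P] fun _ => 1 / (n : ℝ)
  /-- given the past movements and the recalled instant, the new movement is Bernoulli, with
  parameter `p` if the recalled movement is `1` and `q` if it is `0` -/
  step : ∀ n, 1 ≤ n →
    P⟦{ω | X (n + 1) ω = 1} | mrwPast X n ⊔ MeasurableSpace.comap (K (n + 1)) ⊤⟧
      =ᵐ[P] fun ω => if X (K (n + 1) ω) ω = 1 then p else q

/-- The position at time `n` of the walk with movements `X`. -/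
def mrwPosition {Ω : Type*} (X : ℕ → Ω → ℝ) (n : ℕ) (ω : Ω) : ℝ :=
  ∑ i ∈ Finset.Icc 1 n, X i ω

/-- The asymptotic variance `σ²`, where `α = p - q`. -/
noncomputable def mrwSigmaSq (p q : ℝ) : ℝ :=
  q * (1 - p) / (1 - (p - q)) ^ 2

/-! Put a = p - q, μ = q / (1 - a), let N_k be the number of ones up to time k, and y_k = (N_k - kμ)
/ √k. Given the past, the next movement is 1 with probability q + a N_k / k, and μ is the fixed
point of x ↦ q + a x. A Taylor expansion therefore gives y_{k+1}^(2r+2) = y_k^(2r+2) - c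
y_k^(2r+2)/k + d y_k^(2r)/k + E_k + D_k, with c = (r+1)(1-2a), d = (r+1)(2r+1)σ², an error E_k =
O(k^(-3/2)(1 + y_k^(2r+2))) and a martingale difference D_k = O(k^(-1/2)(1 + y_k^(2r+2)))
(`exists_fluct_pow_decomposition`).

In the diffusive regime c > 0, so the recursion contracts and all even moments of y_k stay bounded
(`exists_integral_fluct_pow_le`). Summing it over k ≤ n, the left side telescopes, the E_k
contribute O(1) in L² and the orthogonal D_k contribute O(√log n). Hence c ∑ y_k^(2r+2)/k and d ∑
y_k^(2r)/k differ by O(√log n) in L². By induction on r, ∑ y_k^(2r)/k is within O(√log n) in L² of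
L_r times a harmonic number, where c L_{r+1} = d L_r and L_0 = 1: the even moments of a centred
Gaussian law of variance σ²/(1-2a) (`exists_integral_logMoment_sub_sq_le`).

Since these sums increase with n, convergence along a sparse subsequence, obtained from summable
second moments, extends to all n (`ae_tendsto_div_log_of_integral_sq_le`). At each fixed time
everything is bounded, so integrability is free, and conditioning is only used by testing against
bounded past-measurable functions. -/

/-! ### Bounded measurable functions and conditioning -/

/-- Real functions that are measurable with respect to `m` and bounded. -/
def IsBddMeasurable {Ω : Type*} (m : MeasurableSpace Ω) (f : Ω → ℝ) : Prop :=
  Measurable[m] f ∧ ∃ C, ∀ ω, |f ω| ≤ C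

namespace IsBddMeasurable

variable {Ω : Type*} {m m' : MeasurableSpace Ω} {f g : Ω → ℝ}

theorem mono (hf : IsBddMeasurable m f) (h : m ≤ m') : IsBddMeasurable m' f :=
  ⟨hf.1.mono h le_rfl, hf.2⟩

theorem const (c : ℝ) : IsBddMeasurable m (fun _ => c) :=
  ⟨measurable_const, |c|, fun _ => le_rfl⟩

theorem add (hf : IsBddMeasurable m f) (hg : IsBddMeasurable m g) :
    IsBddMeasurable m (fun ω => f ω + g ω) := by
  obtain ⟨hf, C, hC⟩ := hf
  obtain ⟨hg, D, hD⟩ := hg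
  exact ⟨hf.add hg, C + D, fun ω => (abs_add_le _ _).trans (add_le_add (hC ω) (hD ω))⟩

theorem mul (hf : IsBddMeasurable m f) (hg : IsBddMeasurable m g) :
    IsBddMeasurable m (fun ω => f ω * g ω) := by
  obtain ⟨hf, C, hC⟩ := hf
  obtain ⟨hg, D, hD⟩ := hg
  refine ⟨hf.mul hg, C * D, fun ω => ?_⟩
  rw [abs_mul]
  exact mul_le_mul (hC ω) (hD ω) (abs_nonneg _) ((abs_nonneg _).trans (hC ω))

theorem sub (hf : IsBddMeasurable m f) (hg : IsBddMeasurable m g) :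
    IsBddMeasurable m (fun ω => f ω - g ω) := by
  simpa [sub_eq_add_neg] using hf.add ((const (-1)).mul hg)

theorem div_const (hf : IsBddMeasurable m f) (c : ℝ) :
    IsBddMeasurable m (fun ω => f ω / c) := by
  simpa [div_eq_mul_inv] using hf.mul (const c⁻¹)

theorem pow (hf : IsBddMeasurable m f) (n : ℕ) : IsBddMeasurable m (fun ω => f ω ^ n) := by
  induction n with
  | zero => simpa using const 1
  | succ n ih => simpa [pow_succ] using ih.mul hf

theorem sum {ι : Type*} (s : Finset ι) {f : ι → Ω → ℝ}
    (hf : ∀ i ∈ s, IsBddMeasurable m (f i)) : IsBddMeasurable m (fun ω => ∑ i ∈ s, f i ω) := by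
  classical
  induction s using Finset.induction_on with
  | empty => simpa using const 0
  | insert i s hi ih =>
    simp only [Finset.sum_insert hi]
    exact (hf i (Finset.mem_insert_self _ _)).add
      (ih fun j hj => hf j (Finset.mem_insert_of_mem hj))

theorem indicator_one {s : Set Ω} (hs : MeasurableSet[m] s) :
    IsBddMeasurable m (s.indicator fun _ => (1 : ℝ)) :=
  ⟨measurable_const.indicator hs, 1, fun ω => by
    by_cases h : ω ∈ s <;> simp [h]⟩

theorem integrable {m0 : MeasurableSpace Ω} {P : Measure Ω} [IsFiniteMeasure P]
    (hf : IsBddMeasurable m0 f) : Integrable f P := by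
  obtain ⟨hf, C, hC⟩ := hf
  exact Integrable.of_bound hf.aestronglyMeasurable C (ae_of_all _ hC)

end IsBddMeasurable

/-- Conditional expectations may be replaced inside an integral against a bounded function that
is measurable with respect to the conditioning σ-algebra. -/
theorem integral_mul_eq_of_condExp_ae_eq {Ω : Type*} {m m0 : MeasurableSpace Ω} {P : Measure Ω}
    [IsFiniteMeasure P] (hm : m ≤ m0) {f g Y : Ω → ℝ} (hf : Integrable f P)
    (hfg : P[f | m] =ᵐ[P] g) (hY : IsBddMeasurable m Y) :
    ∫ ω, Y ω * f ω ∂P = ∫ ω, Y ω * g ω ∂P := by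
  obtain ⟨hYm, C, hC⟩ := hY
  have hint : Integrable (Y * f) P :=
    hf.bdd_mul (hYm.mono hm le_rfl).aestronglyMeasurable (ae_of_all _ hC)
  have h := condExp_mul_of_stronglyMeasurable_left (μ := P) (m := m)
    (Measurable.stronglyMeasurable hYm) hint hf
  have h2 : ∫ ω, (Y * f) ω ∂P = ∫ ω, (P[Y * f | m]) ω ∂P := (integral_condExp hm).symm
  simp only [Pi.mul_apply] at h2
  rw [h2]
  refine integral_congr_ae ?_
  filter_upwards [h, hfg] with ω h1 h2
  rw [h1, Pi.mul_apply, h2]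

/-! ### The count of ones and its conditional law -/

/-- The indicator of a movement being `1`: the movement itself, up to a null set. -/
noncomputable def mrwStep {Ω : Type*} (X : ℕ → Ω → ℝ) (n : ℕ) : Ω → ℝ :=
  Set.indicator {ω | X n ω = 1} fun _ => 1

/-- The number of indices `i ∈ {1, …, n}` for which the movement `X i` is `1`. -/
noncomputable def mrwCount {Ω : Type*} (X : ℕ → Ω → ℝ) (n : ℕ) (ω : Ω) : ℝ :=
  ∑ i ∈ Finset.Icc 1 n, mrwStep X i ω

section

variable {Ω : Type*} {X : ℕ → Ω → ℝ}

theorem mrwStep_eq_zero_or_one (n : ℕ) (ω : Ω) : mrwStep X n ω = 0 ∨ mrwStep X n ω = 1 := by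
  by_cases h : X n ω = 1 <;> simp [mrwStep, h]

theorem mrwPast_mono : Monotone (mrwPast X) := fun _ _ h =>
  biSup_mono fun _ hi => Finset.Icc_subset_Icc_right h hi

theorem isBddMeasurable_mrwStep {i n : ℕ} (hi : i ∈ Finset.Icc 1 n) :
    IsBddMeasurable (mrwPast X n) (mrwStep X i) := by
  refine IsBddMeasurable.mono (m := MeasurableSpace.comap (X i) inferInstance) ?_
    (le_iSup₂_of_le i hi le_rfl)
  exact IsBddMeasurable.indicator_one ⟨{1}, measurableSet_singleton 1, rfl⟩

theorem isBddMeasurable_mrwCount (n : ℕ) : IsBddMeasurable (mrwPast X n) (mrwCount X n) :=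
  IsBddMeasurable.sum _ fun _ hi => isBddMeasurable_mrwStep hi

theorem mrwCount_succ (n : ℕ) (ω : Ω) :
    mrwCount X (n + 1) ω = mrwCount X n ω + mrwStep X (n + 1) ω :=
  Finset.sum_Icc_succ_top (by omega) _

theorem mrwCount_nonneg (n : ℕ) (ω : Ω) : 0 ≤ mrwCount X n ω :=
  Finset.sum_nonneg fun i _ => by rcases mrwStep_eq_zero_or_one (X := X) i ω with h | h <;> simp [h]

theorem mrwCount_le (n : ℕ) (ω : Ω) : mrwCount X n ω ≤ n := by
  refine (Finset.sum_le_card_nsmul _ _ 1 fun i _ => ?_).trans (by simp)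
  rcases mrwStep_eq_zero_or_one (X := X) i ω with h | h <;> simp [h]

end

namespace IsMinimalRandomWalk

variable {Ω : Type*} [MeasurableSpace Ω] {P : Measure Ω}
  {p q s : ℝ} {X : ℕ → Ω → ℝ} {K : ℕ → Ω → ℕ}

theorem mrwPast_le (hX : IsMinimalRandomWalk P p q s X K) (n : ℕ) :
    mrwPast X n ≤ ‹MeasurableSpace Ω› :=
  iSup₂_le fun i hi => (hX.measurable_X i (Finset.mem_Icc.1 hi).1).comap_le

/-- Movements are 0 or 1 only almost surely, while the indicators are so at every point. The proof
works with the indicators and pays one null set here to return to the walk. -/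
theorem mrwPosition_eq_mrwCount (hX : IsMinimalRandomWalk P p q s X K) :
    ∀ᵐ ω ∂P, ∀ n, mrwPosition X n ω = mrwCount X n ω := by
  have h : ∀ᵐ ω ∂P, ∀ n, 1 ≤ n → X n ω = 0 ∨ X n ω = 1 := by
    rw [ae_all_iff]
    intro n
    by_cases hn : 1 ≤ n
    · filter_upwards [hX.zero_or_one n hn] with ω h _ using h
    · exact ae_of_all _ fun _ h => absurd h hn
  filter_upwards [h] with ω h n
  refine Finset.sum_congr rfl fun i hi => ?_
  rcases h i (Finset.mem_Icc.1 hi).1 with h | h <;> simp [mrwStep, h]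

variable [IsProbabilityMeasure P]

/-- The n instants of {1, …, n} carry mass 1/n each, which leaves no mass elsewhere. -/
theorem recalled_mem (hX : IsMinimalRandomWalk P p q s X K) {n : ℕ} (hn : 1 ≤ n) :
    ∀ᵐ ω ∂P, K (n + 1) ω ∈ Finset.Icc 1 n := by
  have hK := hX.measurable_K (n + 1) (by omega)
  have hm : ∀ j, MeasurableSet {ω | K (n + 1) ω = j} := fun j => hK (measurableSet_singleton j)
  have hj : ∀ j ∈ Finset.Icc 1 n, P.real {ω | K (n + 1) ω = j} = 1 / n := by
    intro j hj
    have h1 : Integrable ({ω | K (n + 1) ω = j}.indicator fun _ => (1 : ℝ)) P :=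
      (IsBddMeasurable.indicator_one (hm j)).integrable
    have := integral_mul_eq_of_condExp_ae_eq (hX.mrwPast_le n) h1 (hX.uniform n hn j hj)
      (IsBddMeasurable.const 1)
    simpa [integral_indicator (hm j)] using this
  have hU : P.real {ω | K (n + 1) ω ∈ Finset.Icc 1 n} = 1 := by
    have : {ω | K (n + 1) ω ∈ Finset.Icc 1 n}
        = ⋃ j ∈ Finset.Icc 1 n, {ω | K (n + 1) ω = j} := by ext; simp
    rw [this, measureReal_biUnion_finset _ fun j _ => hm j, Finset.sum_congr rfl hj]
    · have : (n : ℝ) ≠ 0 := by positivity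
      simp [this]
    · intro i _ j _ hij
      refine Set.disjoint_left.2 fun ω h1 h2 => hij ?_
      exact h1.symm.trans h2
  have hUm : MeasurableSet {ω | K (n + 1) ω ∈ Finset.Icc 1 n} :=
    hK (Finset.measurableSet (Finset.Icc 1 n))
  rw [ae_iff_measure_eq hUm.nullMeasurableSet, measure_univ]
  have := ENNReal.ofReal_toReal (measure_ne_top P {ω | K (n + 1) ω ∈ Finset.Icc 1 n})
  rw [← this, ← Measure.real, hU, ENNReal.ofReal_one]

/-- Given the past, the movement `X (n + 1)` is `1` with probability
`q + (p - q) * mrwCount X n / n`. -/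
theorem integral_mul_innovation (hX : IsMinimalRandomWalk P p q s X K) {n : ℕ} (hn : 1 ≤ n)
    {Y : Ω → ℝ} (hY : IsBddMeasurable (mrwPast X n) Y) :
    ∫ ω, Y ω * (mrwStep X (n + 1) ω - (q + (p - q) * (mrwCount X n ω / n))) ∂P = 0 := by
  have hK := hX.measurable_K (n + 1) (by omega)
  have hF := hX.mrwPast_le n
  have hle : mrwPast X n ⊔ MeasurableSpace.comap (K (n + 1)) ⊤ ≤ ‹MeasurableSpace Ω› :=
    sup_le hF (@Measurable.comap_le _ _ _ ⊤ _ hK)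
  have hm : ∀ j, MeasurableSet {ω | K (n + 1) ω = j} := fun j => hK (measurableSet_singleton j)
  have hx : IsBddMeasurable _ (mrwStep X (n + 1)) :=
    (isBddMeasurable_mrwStep (Finset.mem_Icc.2 ⟨by omega, le_rfl⟩)).mono (hX.mrwPast_le (n + 1))
  have hc : IsBddMeasurable (mrwPast X n) fun ω => q + (p - q) * (mrwCount X n ω / n) :=
    (IsBddMeasurable.const q).add
      ((IsBddMeasurable.const (p - q)).mul ((isBddMeasurable_mrwCount n).div_const n))
  have hxi : ∀ i ∈ Finset.Icc 1 n,
      IsBddMeasurable (mrwPast X n) fun ω => Y ω * (q + (p - q) * mrwStep X i ω) := fun i hi =>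
    hY.mul ((IsBddMeasurable.const q).add
      ((IsBddMeasurable.const (p - q)).mul (isBddMeasurable_mrwStep hi)))
  have h1 : ∫ ω, Y ω * mrwStep X (n + 1) ω ∂P
      = ∫ ω, Y ω * (if X (K (n + 1) ω) ω = 1 then p else q) ∂P :=
    integral_mul_eq_of_condExp_ae_eq hle hx.integrable (hX.step n hn) (hY.mono le_sup_left)
  -- Splitting over the value i of the recalled instant makes the factor in front of each indicator
  -- measurable with respect to the past alone, so that uniformity applies term by term.
  have h2 : ∫ ω, Y ω * (if X (K (n + 1) ω) ω = 1 then p else q) ∂P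
      = ∫ ω, ∑ i ∈ Finset.Icc 1 n, Y ω * (q + (p - q) * mrwStep X i ω) *
          Set.indicator {ω | K (n + 1) ω = i} (fun _ => (1 : ℝ)) ω ∂P := by
    refine integral_congr_ae ?_
    filter_upwards [hX.recalled_mem hn] with ω hω
    rw [Finset.sum_eq_single_of_mem _ hω]
    · by_cases h : X (K (n + 1) ω) ω = 1 <;> simp [mrwStep, h]
    · intro j _ hj
      simp [hj.symm]
  have h3 : ∀ i ∈ Finset.Icc 1 n, ∫ ω, Y ω * (q + (p - q) * mrwStep X i ω) *
          Set.indicator {ω | K (n + 1) ω = i} (fun _ => (1 : ℝ)) ω ∂P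
      = ∫ ω, Y ω * (q + (p - q) * mrwStep X i ω) * (1 / (n : ℝ)) ∂P := fun i hi =>
    integral_mul_eq_of_condExp_ae_eq hF (IsBddMeasurable.indicator_one (hm i)).integrable
      (hX.uniform n hn i hi) (hxi i hi)
  have h4 : ∫ ω, Y ω * mrwStep X (n + 1) ω ∂P
      = ∫ ω, Y ω * (q + (p - q) * (mrwCount X n ω / n)) ∂P := by
    rw [h1, h2, integral_finsetSum, Finset.sum_congr rfl h3, ← integral_finsetSum]
    · congr 1
      ext ω
      have : (n : ℝ) ≠ 0 := by positivity
      simp only [mrwCount, mul_add, add_mul, Finset.sum_add_distrib, Finset.sum_const,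
        Nat.card_Icc, nsmul_eq_mul, Finset.sum_div, Finset.mul_sum]
      congr 1
      · simp
        field_simp
      · exact Finset.sum_congr rfl fun i _ => by ring
    · exact fun i hi => ((hxi i hi).mono hF |>.mul (IsBddMeasurable.const _)).integrable
    · exact fun i hi => ((hxi i hi).mono hF |>.mul
        (IsBddMeasurable.indicator_one (hm i))).integrable
  simp only [mul_sub]
  rw [integral_sub ((hY.mono hF).mul hx).integrable ((hY.mul hc).mono hF).integrable, h4, sub_self]

end IsMinimalRandomWalk

/-! ### Deterministic expansions for one step -/

/-- Taylor expansion of `(y + δ) ^ m` to order zero, uniformly in `y`. -/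
theorem exists_abs_add_pow_sub_le (m : ℕ) : ∃ C : ℝ, 0 ≤ C ∧ ∀ y δ : ℝ, |δ| ≤ 1 →
    |(y + δ) ^ m - y ^ m| ≤ C * |δ| * (1 + |y|) ^ m := by
  induction m with
  | zero => exact ⟨0, le_rfl, fun y δ _ => by simp⟩
  | succ m ih =>
    obtain ⟨C, hC, h⟩ := ih
    refine ⟨C + 1, by positivity, fun y δ hδ => ?_⟩
    have e : (y + δ) ^ (m + 1) - y ^ (m + 1) = (y + δ) * ((y + δ) ^ m - y ^ m) + δ * y ^ m := by
      ring
    have h1 : |y + δ| ≤ 1 + |y| := (abs_add_le _ _).trans (by linarith)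
    have h2 : |y| ^ m ≤ (1 + |y|) ^ (m + 1) :=
      (pow_le_pow_left₀ (abs_nonneg y) (by linarith) m).trans
        (pow_le_pow_right₀ (by linarith [abs_nonneg y]) (Nat.le_succ m))
    calc |(y + δ) ^ (m + 1) - y ^ (m + 1)|
        ≤ |y + δ| * |(y + δ) ^ m - y ^ m| + |δ| * |y| ^ m := by
          rw [e]
          refine (abs_add_le _ _).trans_eq ?_
          rw [abs_mul, abs_mul, abs_pow]
      _ ≤ (1 + |y|) * (C * |δ| * (1 + |y|) ^ m) + |δ| * (1 + |y|) ^ (m + 1) := by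
          gcongr
          exact h y δ hδ
      _ = (C + 1) * |δ| * (1 + |y|) ^ (m + 1) := by ring

/-- Taylor expansion of `(y + δ) ^ (k + 2)` to order two, uniformly in `y`. -/
theorem exists_abs_add_pow_sub_taylor_le (k : ℕ) : ∃ C : ℝ, 0 ≤ C ∧ ∀ y δ : ℝ, |δ| ≤ 1 →
    |(y + δ) ^ (k + 2) - (y ^ (k + 2) + (k + 2) * y ^ (k + 1) * δ
      + (k + 2) * (k + 1) / 2 * y ^ k * δ ^ 2)| ≤ C * |δ| ^ 3 * (1 + |y|) ^ (k + 2) := by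
  induction k with
  | zero =>
    refine ⟨0, le_rfl, fun y δ _ => ?_⟩
    rw [show (y + δ) ^ (0 + 2) - (y ^ (0 + 2) + (((0 : ℕ) : ℝ) + 2) * y ^ (0 + 1) * δ
      + (((0 : ℕ) : ℝ) + 2) * (((0 : ℕ) : ℝ) + 1) / 2 * y ^ 0 * δ ^ 2) = 0 by push_cast; ring]
    simp
  | succ k ih =>
    obtain ⟨C, hC, h⟩ := ih
    set D : ℝ := (k + 2) * (k + 1) / 2 with hD
    have hD0 : 0 ≤ D := by positivity
    refine ⟨C + D, by positivity, fun y δ hδ => ?_⟩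
    set R := (y + δ) ^ (k + 2) - (y ^ (k + 2) + (k + 2) * y ^ (k + 1) * δ + D * y ^ k * δ ^ 2)
      with hR
    have e : (y + δ) ^ (k + 1 + 2) - (y ^ (k + 1 + 2) + ((k + 1 : ℕ) + 2) * y ^ (k + 1 + 1) * δ
        + ((k + 1 : ℕ) + 2) * ((k + 1 : ℕ) + 1) / 2 * y ^ (k + 1) * δ ^ 2)
        = (y + δ) * R + D * y ^ k * δ ^ 3 := by
      rw [hR, hD]
      push_cast
      ring
    have h1 : |y + δ| ≤ 1 + |y| := (abs_add_le _ _).trans (by linarith)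
    have h2 : |y| ^ k ≤ (1 + |y|) ^ (k + 1 + 2) :=
      (pow_le_pow_left₀ (abs_nonneg y) (by linarith) k).trans
        (pow_le_pow_right₀ (by linarith [abs_nonneg y]) (by omega))
    rw [e]
    calc |(y + δ) * R + D * y ^ k * δ ^ 3|
        ≤ |y + δ| * |R| + D * |y| ^ k * |δ| ^ 3 := by
          refine (abs_add_le _ _).trans_eq ?_
          rw [abs_mul, abs_mul, abs_mul, abs_pow, abs_pow, abs_of_nonneg hD0]
      _ ≤ (1 + |y|) * (C * |δ| ^ 3 * (1 + |y|) ^ (k + 2))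
          + D * (1 + |y|) ^ (k + 1 + 2) * |δ| ^ 3 := by
          gcongr
          exact h y δ hδ
      _ = (C + D) * |δ| ^ 3 * (1 + |y|) ^ (k + 1 + 2) := by ring

theorem exists_abs_one_add_pow_sub_le (B : ℝ) (hB : 0 ≤ B) (r : ℕ) : ∃ C : ℝ, 0 ≤ C ∧
    ∀ h : ℝ, |h| ≤ B → |(1 + h) ^ r - (1 + r * h)| ≤ C * h ^ 2 := by
  induction r with
  | zero => exact ⟨0, le_rfl, fun h _ => by simp⟩
  | succ r ih =>
    obtain ⟨C, hC, H⟩ := ih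
    refine ⟨(1 + B) * C + r, by positivity, fun h hh => ?_⟩
    have e : (1 + h) ^ (r + 1) - (1 + (r + 1 : ℕ) * h)
        = (1 + h) * ((1 + h) ^ r - (1 + r * h)) + r * h ^ 2 := by
      push_cast
      ring
    have h1 : |1 + h| ≤ 1 + B := (abs_add_le _ _).trans (by simpa using hh)
    calc |(1 + h) ^ (r + 1) - (1 + (r + 1 : ℕ) * h)|
        ≤ |1 + h| * |(1 + h) ^ r - (1 + r * h)| + r * h ^ 2 := by
          rw [e]
          refine (abs_add_le _ _).trans_eq ?_
          rw [abs_mul, abs_of_nonneg (by positivity : 0 ≤ (r : ℝ) * h ^ 2)]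
      _ ≤ (1 + B) * (C * h ^ 2) + r * h ^ 2 := by
          gcongr
          exact H h hh
      _ = ((1 + B) * C + r) * h ^ 2 := by ring

/-- Expansion of the powers of the squared growth factor of the rescaled walk, where `τ ^ 2` is
the inverse of time. -/
theorem exists_abs_growth_pow_sub_le (a : ℝ) (r : ℕ) : ∃ C : ℝ, 0 ≤ C ∧
    ∀ τ : ℝ, 0 < τ → τ ≤ 1 →
      |((1 + a * τ ^ 2) ^ 2 / (1 + τ ^ 2)) ^ r - (1 - r * (1 - 2 * a) * τ ^ 2)| ≤ C * τ ^ 4 := by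
  obtain ⟨C, hC, H⟩ := exists_abs_one_add_pow_sub_le (|1 - 2 * a| + (1 - a) ^ 2) (by positivity) r
  refine ⟨C * (|1 - 2 * a| + (1 - a) ^ 2) ^ 2 + r * (1 - a) ^ 2, by positivity,
    fun τ h0 h1 => ?_⟩
  set B := |1 - 2 * a| + (1 - a) ^ 2 with hB
  have hB0 : 0 ≤ B := by positivity
  have hτ2 : τ ^ 2 ≤ 1 := pow_le_one₀ h0.le h1
  -- The exact remainder: (1 + aτ²)² / (1 + τ²) = 1 - (1 - 2a)τ² + e.
  set e := (1 - a) ^ 2 * τ ^ 4 / (1 + τ ^ 2) with he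
  have he0 : 0 ≤ e := by positivity
  have he1 : e ≤ (1 - a) ^ 2 * τ ^ 4 :=
    div_le_self (by positivity) (by linarith [sq_nonneg τ])
  set h := -(1 - 2 * a) * τ ^ 2 + e with hh
  have hb : (1 + a * τ ^ 2) ^ 2 / (1 + τ ^ 2) = 1 + h := by
    rw [hh, he]
    field_simp
    ring
  have h4 : τ ^ 4 ≤ τ ^ 2 := pow_le_pow_of_le_one h0.le h1 (by norm_num)
  have hle : |h| ≤ B * τ ^ 2 := by
    calc |h| ≤ |-(1 - 2 * a) * τ ^ 2| + |e| := abs_add_le _ _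
      _ = |1 - 2 * a| * τ ^ 2 + e := by
        rw [abs_mul, abs_neg, abs_of_nonneg he0, abs_of_nonneg (sq_nonneg τ)]
      _ ≤ |1 - 2 * a| * τ ^ 2 + (1 - a) ^ 2 * τ ^ 2 := by
        gcongr
        exact he1.trans (by gcongr)
      _ = B * τ ^ 2 := by ring
  have hsq : h ^ 2 ≤ B ^ 2 * τ ^ 4 := by
    rw [← sq_abs]
    calc |h| ^ 2 ≤ (B * τ ^ 2) ^ 2 := by gcongr
      _ = _ := by ring
  have hH := H h (hle.trans (mul_le_of_le_one_right hB0 hτ2))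
  rw [hb]
  calc |(1 + h) ^ r - (1 - r * (1 - 2 * a) * τ ^ 2)|
      = |((1 + h) ^ r - (1 + r * h)) + r * e| := by
        congr 1
        rw [hh]
        ring
    _ ≤ C * h ^ 2 + r * e := by
        refine (abs_add_le _ _).trans ?_
        rw [abs_of_nonneg (by positivity : 0 ≤ (r : ℝ) * e)]
        gcongr
    _ ≤ C * (B ^ 2 * τ ^ 4) + r * ((1 - a) ^ 2 * τ ^ 4) := by gcongr
    _ = _ := by ring

theorem exists_abs_growth_pow_sub_one_le (a : ℝ) (r : ℕ) : ∃ C : ℝ, 0 ≤ C ∧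
    ∀ τ : ℝ, 0 < τ → τ ≤ 1 → |((1 + a * τ ^ 2) ^ 2 / (1 + τ ^ 2)) ^ r - 1| ≤ C * τ ^ 2 := by
  obtain ⟨C, hC, H⟩ := exists_abs_growth_pow_sub_le a r
  refine ⟨C + |r * (1 - 2 * a)|, by positivity, fun τ h0 h1 => ?_⟩
  have h4 : τ ^ 4 ≤ τ ^ 2 := pow_le_pow_of_le_one h0.le h1 (by norm_num)
  set b := ((1 + a * τ ^ 2) ^ 2 / (1 + τ ^ 2)) ^ r with hb
  calc |b - 1| = |(b - (1 - r * (1 - 2 * a) * τ ^ 2)) + (-(r * (1 - 2 * a))) * τ ^ 2| := by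
        congr 1
        ring
    _ ≤ C * τ ^ 4 + |r * (1 - 2 * a)| * τ ^ 2 := by
        refine (abs_add_le _ _).trans ?_
        rw [abs_mul _ (τ ^ 2), abs_neg, abs_of_nonneg (sq_nonneg τ)]
        gcongr
        exact H τ h0 h1
    _ ≤ C * τ ^ 2 + |r * (1 - 2 * a)| * τ ^ 2 := by gcongr
    _ = _ := by ring

theorem one_add_abs_pow_le (y : ℝ) (r : ℕ) : (1 + |y|) ^ (2 * r) ≤ 4 ^ r * (1 + y ^ (2 * r)) := by
  have h := add_pow_le (zero_le_one (α := ℝ)) (abs_nonneg y) (2 * r)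
  have e : |y| ^ (2 * r) = y ^ (2 * r) := by rw [pow_mul, sq_abs, ← pow_mul]
  rw [one_pow, e] at h
  refine h.trans ?_
  have : (2 : ℝ) ^ (2 * r - 1) ≤ 4 ^ r := by
    rw [show (4 : ℝ) = 2 ^ 2 by norm_num, ← pow_mul]
    exact pow_le_pow_right₀ (by norm_num) (Nat.sub_le _ _)
  have h0 : 0 ≤ y ^ (2 * r) := by rw [pow_mul]; positivity
  gcongr

theorem abs_le_of_sq_eq_growth_mul {a τ y u : ℝ} (h0 : 0 < τ) (h1 : τ ≤ 1)
    (hu : u ^ 2 = (1 + a * τ ^ 2) ^ 2 / (1 + τ ^ 2) * y ^ 2) : |u| ≤ (1 + |a|) * |y| := by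
  have hτ2 : τ ^ 2 ≤ 1 := pow_le_one₀ h0.le h1
  have h2 : |1 + a * τ ^ 2| ≤ 1 + |a| := by
    refine (abs_add_le _ _).trans ?_
    rw [abs_one, abs_mul, abs_of_nonneg (sq_nonneg τ)]
    gcongr
    exact mul_le_of_le_one_right (abs_nonneg a) hτ2
  refine abs_le_of_sq_le_sq' ?_ (by positivity) |> abs_le.2
  calc u ^ 2 = (1 + a * τ ^ 2) ^ 2 / (1 + τ ^ 2) * y ^ 2 := hu
    _ ≤ (1 + a * τ ^ 2) ^ 2 * y ^ 2 := by
      gcongr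
      exact div_le_self (sq_nonneg _) (by linarith [sq_nonneg τ])
    _ = |1 + a * τ ^ 2| ^ 2 * |y| ^ 2 := by rw [sq_abs, sq_abs]
    _ ≤ (1 + |a|) ^ 2 * |y| ^ 2 := by gcongr
    _ = ((1 + |a|) * |y|) ^ 2 := by ring

/-- The conditional law of the rescaled position at the next step charges the two points
`u + t * (1 - π)` and `u - t * π`: their even powers are close to each other. -/
theorem exists_abs_two_point_sub_le (a : ℝ) (r : ℕ) : ∃ C : ℝ, 0 ≤ C ∧
    ∀ τ t u y π : ℝ, 0 < τ → τ ≤ 1 → 0 ≤ t → t ≤ τ → 0 ≤ π → π ≤ 1 →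
      u ^ 2 = (1 + a * τ ^ 2) ^ 2 / (1 + τ ^ 2) * y ^ 2 →
      |(u + t * (1 - π)) ^ (2 * r) - (u - t * π) ^ (2 * r)| ≤ C * τ * (1 + y ^ (2 * r)) := by
  obtain ⟨C, hC, H⟩ := exists_abs_add_pow_sub_le (2 * r)
  refine ⟨2 * C * (1 + |a|) ^ (2 * r) * 4 ^ r, by positivity,
    fun τ t u y π h0 h1 ht htτ hπ0 hπ1 hu => ?_⟩
  have hua := abs_le_of_sq_eq_growth_mul h0 h1 hu
  have key : ∀ δ, |δ| ≤ t → |(u + δ) ^ (2 * r) - u ^ (2 * r)|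
      ≤ C * τ * ((1 + |a|) ^ (2 * r) * (4 ^ r * (1 + y ^ (2 * r)))) := by
    intro δ hδ
    have h2 : 1 + |u| ≤ (1 + |a|) * (1 + |y|) := by nlinarith [abs_nonneg a, abs_nonneg y]
    calc _ ≤ C * |δ| * (1 + |u|) ^ (2 * r) := H u δ (by linarith)
      _ ≤ C * τ * ((1 + |a|) * (1 + |y|)) ^ (2 * r) := by
        gcongr
        exact hδ.trans htτ
      _ ≤ _ := by
        rw [mul_pow]
        gcongr
        exact one_add_abs_pow_le y r
  have k1 := key (t * (1 - π)) (by rw [abs_of_nonneg (by nlinarith)]; nlinarith)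
  have k2 := key (-(t * π)) (by rw [abs_neg, abs_of_nonneg (by positivity)]; nlinarith)
  rw [← sub_eq_add_neg] at k2
  calc _ = |((u + t * (1 - π)) ^ (2 * r) - u ^ (2 * r))
          - ((u - t * π) ^ (2 * r) - u ^ (2 * r))| := by congr 1; ring
    _ ≤ _ := abs_sub _ _
    _ ≤ _ := add_le_add k1 k2
    _ = _ := by ring

set_option maxHeartbeats 1000000 in
/-- Second order expansion of the conditional even moments of the rescaled position at the next
step. -/
theorem exists_abs_two_point_mean_sub_le (a : ℝ) (r : ℕ) : ∃ C : ℝ, 0 ≤ C ∧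
    ∀ τ t u y π μ : ℝ, 0 < τ → τ ≤ 1 → 0 ≤ t → t ^ 2 = τ ^ 2 / (1 + τ ^ 2) → 0 ≤ π → π ≤ 1 →
      0 ≤ μ → μ ≤ 1 → |π - μ| ≤ |a| * τ * |y| →
      u ^ 2 = (1 + a * τ ^ 2) ^ 2 / (1 + τ ^ 2) * y ^ 2 →
      |(π * (u + t * (1 - π)) ^ (2 * r + 2) + (1 - π) * (u - t * π) ^ (2 * r + 2))
        - (y ^ (2 * r + 2) - (r + 1) * (1 - 2 * a) * τ ^ 2 * y ^ (2 * r + 2)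
          + (r + 1) * (2 * r + 1) * (μ * (1 - μ)) * τ ^ 2 * y ^ (2 * r))|
      ≤ C * τ ^ 3 * (1 + y ^ (2 * r + 2)) := by
  obtain ⟨C₁, hC₁, H₁⟩ := exists_abs_add_pow_sub_taylor_le (2 * r)
  obtain ⟨C₂, hC₂, H₂⟩ := exists_abs_growth_pow_sub_le a (r + 1)
  obtain ⟨C₃, hC₃, H₃⟩ := exists_abs_growth_pow_sub_one_le a r
  have hd0 : (0 : ℝ) ≤ (r + 1) * (2 * r + 1) := by positivity
  generalize hd : ((r : ℝ) + 1) * (2 * r + 1) = d at hd0 ⊢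
  refine ⟨(C₁ * (1 + |a|) ^ (2 * r + 2) + C₂ + d * (C₃ + 1 + |a|)) * 4 ^ (r + 1),
    by positivity, fun τ t u y π μ h0 h1 ht ht2 hπ0 hπ1 hμ0 hμ1 hπμ hu => ?_⟩
  have hua := abs_le_of_sq_eq_growth_mul h0 h1 hu
  have htτ2 : t ^ 2 ≤ τ ^ 2 := by
    rw [ht2]
    exact div_le_self (sq_nonneg _) (by linarith [sq_nonneg τ])
  have htτ : t ≤ τ := abs_le_of_sq_le_sq htτ2 h0.le |> le_of_abs_le
  have h4 : τ ^ 4 ≤ τ ^ 3 := pow_le_pow_of_le_one h0.le h1 (by norm_num)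
  set b := (1 + a * τ ^ 2) ^ 2 / (1 + τ ^ 2) with hb
  set W := (1 + |y|) ^ (2 * r + 2) with hW
  have hy1 : |y| ≤ 1 + |y| := by linarith
  have hy2 : (1 : ℝ) ≤ 1 + |y| := by linarith [abs_nonneg y]
  have hW0 : 0 ≤ W := by positivity
  have hyW : ∀ j ≤ 2 * r + 2, |y| ^ j ≤ W := fun j hj =>
    (pow_le_pow_left₀ (abs_nonneg y) hy1 j).trans (pow_le_pow_right₀ hy2 hj)
  have key : ∀ δ, |δ| ≤ t → |(u + δ) ^ (2 * r + 2) - (u ^ (2 * r + 2)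
      + (2 * r + 2) * u ^ (2 * r + 1) * δ + d * u ^ (2 * r) * δ ^ 2)|
      ≤ C₁ * (1 + |a|) ^ (2 * r + 2) * τ ^ 3 * W := by
    intro δ hδ
    have h2 : 1 + |u| ≤ (1 + |a|) * (1 + |y|) := by nlinarith [abs_nonneg a, abs_nonneg y]
    have := H₁ u δ (by linarith)
    push_cast at this
    calc _ = |(u + δ) ^ (2 * r + 2) - (u ^ (2 * r + 2)
          + (2 * r + 2) * u ^ (2 * r + 1) * δ
          + (2 * r + 2) * (2 * r + 1) / 2 * u ^ (2 * r) * δ ^ 2)| := by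
          rw [← hd]
          congr 1
          ring
      _ ≤ C₁ * |δ| ^ 3 * (1 + |u|) ^ (2 * r + 2) := this
      _ ≤ C₁ * τ ^ 3 * ((1 + |a|) * (1 + |y|)) ^ (2 * r + 2) := by
        gcongr
        exact hδ.trans htτ
      _ = _ := by rw [mul_pow]; ring
  have k1 := key (t * (1 - π)) (by rw [abs_of_nonneg (by nlinarith)]; nlinarith)
  have k2 := key (-(t * π)) (by rw [abs_neg, abs_of_nonneg (by positivity)]; nlinarith)
  rw [← sub_eq_add_neg] at k2
  set R₁ := (u + t * (1 - π)) ^ (2 * r + 2) - (u ^ (2 * r + 2)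
      + (2 * r + 2) * u ^ (2 * r + 1) * (t * (1 - π)) + d * u ^ (2 * r) * (t * (1 - π)) ^ 2)
    with hR₁
  set R₂ := (u - t * π) ^ (2 * r + 2) - (u ^ (2 * r + 2)
      + (2 * r + 2) * u ^ (2 * r + 1) * (-(t * π)) + d * u ^ (2 * r) * (-(t * π)) ^ 2)
    with hR₂
  have hE1 : |π * R₁ + (1 - π) * R₂| ≤ C₁ * (1 + |a|) ^ (2 * r + 2) * τ ^ 3 * W := by
    refine (abs_add_le _ _).trans ?_
    rw [abs_mul, abs_mul, abs_of_nonneg hπ0, abs_of_nonneg (sub_nonneg.2 hπ1)]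
    calc _ ≤ π * (C₁ * (1 + |a|) ^ (2 * r + 2) * τ ^ 3 * W)
          + (1 - π) * (C₁ * (1 + |a|) ^ (2 * r + 2) * τ ^ 3 * W) :=
          add_le_add (mul_le_mul_of_nonneg_left k1 hπ0)
            (mul_le_mul_of_nonneg_left k2 (sub_nonneg.2 hπ1))
      _ = _ := by ring
  have hu1 : u ^ (2 * r + 2) = b ^ (r + 1) * y ^ (2 * r + 2) := by
    rw [show 2 * r + 2 = 2 * (r + 1) by ring, pow_mul, pow_mul, hu, mul_pow]
  have hu2 : u ^ (2 * r) = b ^ r * y ^ (2 * r) := by rw [pow_mul, pow_mul, hu, mul_pow]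
  have hE2 : |(b ^ (r + 1) - (1 - (r + 1) * (1 - 2 * a) * τ ^ 2)) * y ^ (2 * r + 2)|
      ≤ C₂ * τ ^ 3 * W := by
    have := H₂ τ h0 h1
    push_cast at this
    rw [abs_mul, abs_pow]
    have := hyW _ le_rfl
    gcongr
    linarith [mul_le_mul_of_nonneg_left h4 hC₂]
  have hv0 : 0 ≤ π * (1 - π) := mul_nonneg hπ0 (by linarith)
  have hv1 : π * (1 - π) ≤ 1 := mul_le_one₀ hπ1 (by linarith) (by linarith)
  -- The map x ↦ x(1 - x) is 1-Lipschitz on [0, 1]. Replacing π by μ costs one extra factor τ|y|,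
  -- which the weight `W` of degree 2r + 2 absorbs.
  have hvar : |π * (1 - π) - μ * (1 - μ)| ≤ |a| * τ * |y| := by
    rw [show π * (1 - π) - μ * (1 - μ) = (π - μ) * (1 - π - μ) by ring, abs_mul]
    refine le_trans ?_ hπμ
    exact mul_le_of_le_one_right (abs_nonneg _) (abs_le.2 ⟨by linarith, by linarith⟩)
  have htt : |t ^ 2 - τ ^ 2| ≤ τ ^ 4 := by
    rw [ht2, show τ ^ 2 / (1 + τ ^ 2) - τ ^ 2 = -(τ ^ 4 / (1 + τ ^ 2)) by field_simp; ring, abs_neg,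
      abs_of_nonneg (by positivity)]
    exact div_le_self (by positivity) (by linarith [sq_nonneg τ])
  have hE3 : |d * (y ^ (2 * r) * (b ^ r * (t ^ 2 * (π * (1 - π))) - τ ^ 2 * (μ * (1 - μ))))|
      ≤ d * (C₃ + 1 + |a|) * τ ^ 3 * W := by
    have hb1 := H₃ τ h0 h1
    rw [abs_mul, abs_mul, abs_of_nonneg hd0, abs_pow]
    have h3 : |b ^ r * (t ^ 2 * (π * (1 - π))) - τ ^ 2 * (μ * (1 - μ))|
        ≤ (C₃ + 1) * τ ^ 3 + |a| * τ ^ 3 * |y| := by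
      rw [show b ^ r * (t ^ 2 * (π * (1 - π))) - τ ^ 2 * (μ * (1 - μ))
        = (b ^ r - 1) * (t ^ 2 * (π * (1 - π))) + (t ^ 2 - τ ^ 2) * (π * (1 - π))
          + τ ^ 2 * (π * (1 - π) - μ * (1 - μ)) by ring]
      refine (abs_add_three _ _ _).trans ?_
      rw [abs_mul (b ^ r - 1), abs_mul (t ^ 2 - τ ^ 2), abs_mul (τ ^ 2), abs_of_nonneg hv0,
        abs_of_nonneg (sq_nonneg τ),
        abs_of_nonneg (mul_nonneg (sq_nonneg t) hv0)]
      have i1 : |b ^ r - 1| * (t ^ 2 * (π * (1 - π))) ≤ C₃ * τ ^ 2 * (τ ^ 2 * 1) := by gcongr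
      have i2 : |t ^ 2 - τ ^ 2| * (π * (1 - π)) ≤ τ ^ 4 * 1 := by gcongr
      have i3 : τ ^ 2 * |π * (1 - π) - μ * (1 - μ)| ≤ τ ^ 2 * (|a| * τ * |y|) := by gcongr
      have i4 := mul_le_mul_of_nonneg_left h4 hC₃
      calc _ ≤ C₃ * τ ^ 2 * (τ ^ 2 * 1) + τ ^ 4 * 1 + τ ^ 2 * (|a| * τ * |y|) :=
            add_le_add (add_le_add i1 i2) i3
        _ = C₃ * τ ^ 4 + τ ^ 4 + |a| * τ ^ 3 * |y| := by ring
        _ ≤ C₃ * τ ^ 3 + τ ^ 3 + |a| * τ ^ 3 * |y| := by gcongr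
        _ = _ := by ring
    have i5 := hyW (2 * r) (by omega)
    have i6 := hyW (2 * r + 1) (by omega)
    calc d * (|y| ^ (2 * r) * |b ^ r * (t ^ 2 * (π * (1 - π))) - τ ^ 2 * (μ * (1 - μ))|)
        ≤ d * (|y| ^ (2 * r) * ((C₃ + 1) * τ ^ 3 + |a| * τ ^ 3 * |y|)) := by gcongr
      _ = d * ((C₃ + 1) * τ ^ 3 * |y| ^ (2 * r) + |a| * τ ^ 3 * |y| ^ (2 * r + 1)) := by ring
      _ ≤ d * ((C₃ + 1) * τ ^ 3 * W + |a| * τ ^ 3 * W) := by gcongr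
      _ = _ := by ring
  -- The displacements t(1 - π) and -tπ have mean zero under the weights π and 1 - π, so the linear
  -- Taylor terms cancel; their second moment is t²π(1 - π).
  have hsplit : (π * (u + t * (1 - π)) ^ (2 * r + 2) + (1 - π) * (u - t * π) ^ (2 * r + 2))
        - (y ^ (2 * r + 2) - (r + 1) * (1 - 2 * a) * τ ^ 2 * y ^ (2 * r + 2)
          + d * (μ * (1 - μ)) * τ ^ 2 * y ^ (2 * r))
      = (π * R₁ + (1 - π) * R₂)
        + (b ^ (r + 1) - (1 - (r + 1) * (1 - 2 * a) * τ ^ 2)) * y ^ (2 * r + 2)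
        + d * (y ^ (2 * r) * (b ^ r * (t ^ 2 * (π * (1 - π))) - τ ^ 2 * (μ * (1 - μ)))) := by
    have e1 := congrArg (fun z => d * t ^ 2 * (π * (1 - π)) * z) hu2
    rw [hR₁, hR₂]
    linear_combination e1 + hu1
  rw [hsplit]
  have hWy := one_add_abs_pow_le y (r + 1)
  rw [show 2 * (r + 1) = 2 * r + 2 by ring] at hWy
  calc _ ≤ _ := abs_add_three _ _ _
    _ ≤ _ := add_le_add (add_le_add hE1 hE2) hE3
    _ = (C₁ * (1 + |a|) ^ (2 * r + 2) + C₂ + d * (C₃ + 1 + |a|)) * τ ^ 3 * W := by ring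
    _ ≤ (C₁ * (1 + |a|) ^ (2 * r + 2) + C₂ + d * (C₃ + 1 + |a|)) * τ ^ 3
        * (4 ^ (r + 1) * (1 + y ^ (2 * r + 2))) := by gcongr
    _ = _ := by ring

/-! ### The rescaled fluctuation: one-step decomposition and moment bounds -/

/-- The rescaled fluctuation of the number of ones around `μ n`. -/
noncomputable def mrwFluct {Ω : Type*} (X : ℕ → Ω → ℝ) (μ : ℝ) (n : ℕ) (ω : Ω) : ℝ :=
  (mrwCount X n ω - n * μ) / √n

theorem isBddMeasurable_mrwFluct {Ω : Type*} {X : ℕ → Ω → ℝ} (μ : ℝ) (n : ℕ) :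
    IsBddMeasurable (mrwPast X n) (mrwFluct X μ n) :=
  ((isBddMeasurable_mrwCount n).sub (IsBddMeasurable.const _)).div_const _

/-- For large k the term C k^(-3/2) is at most c/(2k), and the right side is then at most a convex
combination of m k and 2D/c with weight c/(2k) on the latter. Hence max (m N) (2D/c) remains a bound
from N on. -/
theorem exists_forall_le_of_le_contraction {m : ℕ → ℝ} {c C D : ℝ} (hm : ∀ k, 0 ≤ m k)
    (hc : 0 < c)
    (h : ∀ k : ℕ, 1 ≤ k → m (k + 1) ≤ (1 - c / k + C * (√k)⁻¹ ^ 3) * m k + D / k) :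
    ∃ B, 0 ≤ B ∧ ∀ k, m k ≤ B := by
  have t1 : Tendsto (fun k : ℕ => C * (√(k : ℝ))⁻¹) atTop (𝓝 (C * 0)) :=
    (tendsto_inv_atTop_zero.comp
      (Real.tendsto_sqrt_atTop.comp tendsto_natCast_atTop_atTop)).const_mul C
  rw [mul_zero] at t1
  obtain ⟨N, hN⟩ := eventually_atTop.1 ((t1.eventually_le_const (half_pos hc)).and
    ((tendsto_natCast_atTop_atTop (R := ℝ)).eventually_ge_atTop c |>.and (eventually_ge_atTop 1)))
  have hB : ∀ k, N ≤ k → m k ≤ max (m N) (2 * D / c) := by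
    intro k hk
    induction k, hk using Nat.le_induction with
    | base => exact le_max_left _ _
    | succ k hk ih =>
      obtain ⟨h1, h2, h3⟩ := hN k hk
      set B := max (m N) (2 * D / c)
      have hk0 : (0 : ℝ) < k := by positivity
      have e : (√(k : ℝ))⁻¹ ^ 3 = (√(k : ℝ))⁻¹ / k := by
        rw [pow_succ, inv_pow, Real.sq_sqrt hk0.le]
        field_simp
      have h4 : C * (√(k : ℝ))⁻¹ ^ 3 ≤ c / 2 / k := by
        rw [e, ← mul_div_assoc]
        gcongr
      have h5 : D / k ≤ c / 2 / k * B := by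
        have : D ≤ c / 2 * B := by
          have := le_max_right (m N) (2 * D / c)
          rw [div_le_iff₀ hc] at this
          linarith
        calc D / k ≤ c / 2 * B / k := by gcongr
          _ = _ := by ring
      have h6 : c / 2 / k ≤ 1 := by
        rw [div_le_one hk0]
        linarith
      calc m (k + 1) ≤ _ := h k h3
        _ ≤ (1 - c / 2 / k) * m k + D / k := by
          have : 1 - c / k + C * (√(k : ℝ))⁻¹ ^ 3 ≤ 1 - c / 2 / k := by
            have : c / (k : ℝ) = c / 2 / k + c / 2 / k := by ring
            linarith
          gcongr
          exact hm k
        _ ≤ (1 - c / 2 / k) * B + c / 2 / k * B := by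
          have : 0 ≤ 1 - c / 2 / k := by linarith
          gcongr
        _ = B := by ring
  have hs : 0 ≤ ∑ i ∈ Finset.range N, m i := Finset.sum_nonneg fun i _ => hm i
  -- The added sum covers the finitely many indices below N.
  refine ⟨max (m N) (2 * D / c) + ∑ i ∈ Finset.range N, m i, ?_, fun k => ?_⟩
  · exact add_nonneg ((hm N).trans (le_max_left _ _)) hs
  · rcases lt_or_ge k N with hk | hk
    · have := Finset.single_le_sum (fun i _ => hm i) (Finset.mem_range.2 hk)
      linarith [(hm N).trans (le_max_left (m N) (2 * D / c))]
    · linarith [hB k hk]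

theorem mrw_mean_mem_Icc {p q : ℝ} (hp1 : p ≤ 1) (hq : 0 ≤ q) (hα : p - q < 1) :
    q / (1 - (p - q)) ∈ Set.Icc (0 : ℝ) 1 := by
  have : 0 < 1 - (p - q) := by linarith
  exact ⟨by positivity, (div_le_one this).2 (by linarith)⟩

/-- σ² is the variance of a Bernoulli variable of parameter μ; it enters as the leading term of the
conditional variance of a movement. -/
theorem mrw_mean_mul_one_sub {p q : ℝ} (hα : p - q < 1) :
    q / (1 - (p - q)) * (1 - q / (1 - (p - q))) = mrwSigmaSq p q := by
  have : 1 - (p - q) ≠ 0 := by linarith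
  rw [mrwSigmaSq]
  field_simp
  ring

namespace IsMinimalRandomWalk

variable {Ω : Type*} [MeasurableSpace Ω] {P : Measure Ω} [IsProbabilityMeasure P]
  {p q s : ℝ} {X : ℕ → Ω → ℝ} {K : ℕ → Ω → ℕ}

/-- One step of the even powers of the rescaled fluctuation: drift, small error, and a martingale
difference. -/
theorem exists_fluct_pow_decomposition (hX : IsMinimalRandomWalk P p q s X K)
    (hp : p ∈ Set.Icc (0 : ℝ) 1) (hq : q ∈ Set.Icc (0 : ℝ) 1) (hα : p - q < 1) (r : ℕ) :
    ∃ C : ℝ, 0 ≤ C ∧ ∃ E D : ℕ → Ω → ℝ, ∀ k : ℕ, 1 ≤ k →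
      (∀ ω, mrwFluct X (q / (1 - (p - q))) (k + 1) ω ^ (2 * r + 2)
        = mrwFluct X (q / (1 - (p - q))) k ω ^ (2 * r + 2)
          - (r + 1) * (1 - 2 * (p - q)) * (mrwFluct X (q / (1 - (p - q))) k ω ^ (2 * r + 2) / k)
          + (r + 1) * (2 * r + 1) * mrwSigmaSq p q *
            (mrwFluct X (q / (1 - (p - q))) k ω ^ (2 * r) / k)
          + E k ω + D k ω) ∧
      IsBddMeasurable (mrwPast X k) (E k) ∧
      (∀ ω, |E k ω| ≤ C * (√k)⁻¹ ^ 3 *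
        (1 + mrwFluct X (q / (1 - (p - q))) k ω ^ (2 * r + 2))) ∧
      IsBddMeasurable (mrwPast X (k + 1)) (D k) ∧
      (∀ ω, |D k ω| ≤ C * (√k)⁻¹ * (1 + mrwFluct X (q / (1 - (p - q))) k ω ^ (2 * r + 2))) ∧
      ∀ Y, IsBddMeasurable (mrwPast X k) Y → ∫ ω, Y ω * D k ω ∂P = 0 := by
  obtain ⟨C₁, hC₁, H₁⟩ := exists_abs_two_point_sub_le (p - q) (r + 1)
  obtain ⟨C₂, hC₂, H₂⟩ := exists_abs_two_point_mean_sub_le (p - q) r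
  obtain ⟨hμ0, hμ1⟩ := mrw_mean_mem_Icc hp.2 hq.1 hα
  set a := p - q with ha
  set μ := q / (1 - a) with hμ
  -- The fixed-point equation of x ↦ q + a x; it makes the conditional mean of the centred count
  -- linear in that count.
  have hqμ : q = μ * (1 - a) := by
    rw [hμ, div_mul_cancel₀]
    linarith
  have hσ : mrwSigmaSq p q = μ * (1 - μ) := (mrw_mean_mul_one_sub hα).symm
  set y := mrwFluct X μ with hy
  -- `rate` is the conditional probability of a one, `u` the conditional mean of y (k + 1), and
  -- `up`, `dn` the values of y (k + 1) ^ (2r + 2) when the movement is 1 or 0.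
  let rate : ℕ → Ω → ℝ := fun k ω => q + a * (mrwCount X k ω / k)
  let u : ℕ → Ω → ℝ := fun k ω => (1 + a / k) * (√k / √(k + 1)) * y k ω
  let up : ℕ → Ω → ℝ := fun k ω => (u k ω + (√(k + 1))⁻¹ * (1 - rate k ω)) ^ (2 * r + 2)
  let dn : ℕ → Ω → ℝ := fun k ω => (u k ω - (√(k + 1))⁻¹ * rate k ω) ^ (2 * r + 2)
  let drift : ℕ → Ω → ℝ := fun k ω => y k ω ^ (2 * r + 2)
          - (r + 1) * (1 - 2 * a) * (y k ω ^ (2 * r + 2) / k)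
          + (r + 1) * (2 * r + 1) * mrwSigmaSq p q * (y k ω ^ (2 * r) / k)
  -- A function of a 0-1 variable ε is affine in it: it equals rate·up + (1 - rate)·dn + (up - dn)(ε
  -- - rate). The error is this conditional mean minus the drift, and the last term is the
  -- martingale difference.
  refine ⟨C₁ + C₂, by positivity,
    fun k ω => rate k ω * up k ω + (1 - rate k ω) * dn k ω - drift k ω,
    fun k ω => (up k ω - dn k ω) * (mrwStep X (k + 1) ω - rate k ω), fun k hk => ?_⟩
  have hk0 : (0 : ℝ) < k := by positivity
  have hsk : 0 < √(k : ℝ) := Real.sqrt_pos.2 hk0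
  have hsk1 : 0 < √((k : ℝ) + 1) := Real.sqrt_pos.2 (by positivity)
  have hsq : √(k : ℝ) ^ 2 = k := Real.sq_sqrt hk0.le
  have hsq1 : √((k : ℝ) + 1) ^ 2 = k + 1 := Real.sq_sqrt (by positivity)
  have hyb : IsBddMeasurable (mrwPast X k) (y k) := isBddMeasurable_mrwFluct μ k
  have hrateb : IsBddMeasurable (mrwPast X k) (rate k) :=
    (IsBddMeasurable.const q).add
      ((IsBddMeasurable.const a).mul ((isBddMeasurable_mrwCount k).div_const k))
  have hub : IsBddMeasurable (mrwPast X k) (u k) := (IsBddMeasurable.const _).mul hyb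
  have hupb : IsBddMeasurable (mrwPast X k) (up k) :=
    (hub.add ((IsBddMeasurable.const _).mul ((IsBddMeasurable.const 1).sub hrateb))).pow _
  have hdnb : IsBddMeasurable (mrwPast X k) (dn k) :=
    (hub.sub ((IsBddMeasurable.const _).mul hrateb)).pow _
  have hdriftb : IsBddMeasurable (mrwPast X k) (drift k) :=
    ((hyb.pow _).sub ((IsBddMeasurable.const _).mul ((hyb.pow _).div_const _))).add
      ((IsBddMeasurable.const _).mul ((hyb.pow _).div_const _))
  have hpast : mrwPast X k ≤ mrwPast X (k + 1) := mrwPast_mono (Nat.le_succ k)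
  have hstepb : IsBddMeasurable (mrwPast X (k + 1)) (mrwStep X (k + 1)) :=
    isBddMeasurable_mrwStep (Finset.mem_Icc.2 ⟨by omega, le_rfl⟩)
  have hrate : ∀ ω, 0 ≤ rate k ω ∧ rate k ω ≤ 1 := by
    intro ω
    have h0 : 0 ≤ mrwCount X k ω / k := div_nonneg (mrwCount_nonneg k ω) hk0.le
    have h1 : mrwCount X k ω / k ≤ 1 := (div_le_one hk0).2 (mrwCount_le k ω)
    have e : rate k ω = (1 - mrwCount X k ω / k) * q + mrwCount X k ω / k * p := by
      simp only [rate, ha]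
      ring
    rw [e]
    constructor
    · have := hp.1
      have := hq.1
      have : 0 ≤ 1 - mrwCount X k ω / k := by linarith
      positivity
    · nlinarith [hp.2, hq.2]
  have hτ0 : 0 < (√(k : ℝ))⁻¹ := inv_pos.2 hsk
  have hτ1 : (√(k : ℝ))⁻¹ ≤ 1 :=
    inv_le_one_of_one_le₀ (Real.one_le_sqrt.2 (by exact_mod_cast hk))
  have hτ2 : (√(k : ℝ))⁻¹ ^ 2 = (k : ℝ)⁻¹ := by rw [inv_pow, hsq]
  have ht0 : 0 ≤ (√((k : ℝ) + 1))⁻¹ := inv_nonneg.2 hsk1.le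
  have ht1 : (√((k : ℝ) + 1))⁻¹ ≤ (√(k : ℝ))⁻¹ := by
    gcongr
    linarith
  have ht2 : (√((k : ℝ) + 1))⁻¹ ^ 2 = (√(k : ℝ))⁻¹ ^ 2 / (1 + (√(k : ℝ))⁻¹ ^ 2) := by
    rw [hτ2, inv_pow, hsq1]
    field_simp
  have hu2 : ∀ ω, u k ω ^ 2
      = (1 + a * (√(k : ℝ))⁻¹ ^ 2) ^ 2 / (1 + (√(k : ℝ))⁻¹ ^ 2) * y k ω ^ 2 := by
    intro ω
    simp only [u]
    rw [hτ2, mul_pow, mul_pow, div_pow, hsq, hsq1]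
    field_simp
  have hratesub : ∀ ω, rate k ω - μ = a * (√(k : ℝ))⁻¹ * y k ω := by
    intro ω
    have : a * (√(k : ℝ))⁻¹ * y k ω = a * ((mrwCount X k ω - k * μ) / k) := by
      rw [show y k ω = (mrwCount X k ω - k * μ) / √(k : ℝ) from rfl,
        show ∀ z, a * (√(k : ℝ))⁻¹ * (z / √(k : ℝ)) = a * (z / √(k : ℝ) ^ 2) from
          fun z => by field_simp, hsq]
    rw [this]
    simp only [rate]
    field_simp
    linear_combination (k : ℝ) * hqμ
  refine ⟨fun ω => ?_, ?_, fun ω => ?_, ?_, fun ω => ?_, fun Y hY => ?_⟩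
  · have e : y (k + 1) ω = u k ω + (√((k : ℝ) + 1))⁻¹ * (mrwStep X (k + 1) ω - rate k ω) := by
      have e1 : y k ω = (mrwCount X k ω - k * μ) / √(k : ℝ) := rfl
      have e2 : y (k + 1) ω = (mrwCount X (k + 1) ω - (k + 1 : ℕ) * μ) / √((k + 1 : ℕ) : ℝ) := rfl
      rw [e2, mrwCount_succ]
      simp only [u, rate, e1]
      push_cast
      field_simp
      linear_combination (k : ℝ) * hqμ
    have e3 : y (k + 1) ω ^ (2 * r + 2)
        = rate k ω * up k ω + (1 - rate k ω) * dn k ω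
          + (up k ω - dn k ω) * (mrwStep X (k + 1) ω - rate k ω) := by
      rw [e]
      simp only [up, dn]
      rcases mrwStep_eq_zero_or_one (X := X) (k + 1) ω with h | h <;> rw [h] <;> ring
    rw [e3]
    simp only [drift]
    ring
  · exact ((hrateb.mul hupb).add (((IsBddMeasurable.const 1).sub hrateb).mul hdnb)).sub hdriftb
  · have := H₂ (√(k : ℝ))⁻¹ (√((k : ℝ) + 1))⁻¹ (u k ω) (y k ω) (rate k ω) μ hτ0 hτ1 ht0 ht2
      (hrate ω).1 (hrate ω).2 hμ0 hμ1
      (by rw [hratesub, abs_mul, abs_mul, abs_of_pos hτ0]) (hu2 ω)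
    have h0 : 0 ≤ 1 + y k ω ^ (2 * r + 2) := by
      rw [show 2 * r + 2 = 2 * (r + 1) by ring, pow_mul]
      positivity
    calc _ = _ := by
          congr 1
          simp only [drift]
          rw [hτ2, hσ]
          ring
      _ ≤ _ := this
      _ ≤ _ := by
        gcongr
        linarith
  · exact ((hupb.sub hdnb).mono hpast).mul (hstepb.sub (hrateb.mono hpast))
  · have := H₁ (√(k : ℝ))⁻¹ (√((k : ℝ) + 1))⁻¹ (u k ω) (y k ω) (rate k ω) hτ0 hτ1 ht0 ht1
      (hrate ω).1 (hrate ω).2 (hu2 ω)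
    rw [show 2 * (r + 1) = 2 * r + 2 by ring] at this
    have h0 : 0 ≤ 1 + y k ω ^ (2 * r + 2) := by
      rw [show 2 * r + 2 = 2 * (r + 1) by ring, pow_mul]
      positivity
    have h1 : |mrwStep X (k + 1) ω - rate k ω| ≤ 1 := by
      have := hrate ω
      rcases mrwStep_eq_zero_or_one (X := X) (k + 1) ω with h | h <;> rw [h, abs_le] <;>
        constructor <;> linarith
    rw [abs_mul]
    calc _ ≤ |up k ω - dn k ω| := mul_le_of_le_one_right (abs_nonneg _) h1
      _ ≤ _ := this
      _ ≤ _ := by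
        gcongr
        linarith
  · have := hX.integral_mul_innovation hk (hY.mul (hupb.sub hdnb))
    simpa only [mul_assoc] using this

/-- Integrating the decomposition removes the martingale term. The condition α < 1/2 makes the drift
coefficient of the top power negative, while the lower power is bounded by induction. -/
theorem exists_integral_fluct_pow_le (hX : IsMinimalRandomWalk P p q s X K)
    (hp : p ∈ Set.Icc (0 : ℝ) 1) (hq : q ∈ Set.Icc (0 : ℝ) 1) (hα : p - q < 1 / 2) (r : ℕ) :
    ∃ B : ℝ, 0 ≤ B ∧ ∀ k, ∫ ω, mrwFluct X (q / (1 - (p - q))) k ω ^ (2 * r) ∂P ≤ B := by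
  induction r with
  | zero => exact ⟨1, zero_le_one, fun k => by simp⟩
  | succ r ih =>
    obtain ⟨B, hB0, hB⟩ := ih
    obtain ⟨C, hC, E, D, H⟩ := hX.exists_fluct_pow_decomposition hp hq (by linarith) r
    have hσ : 0 ≤ mrwSigmaSq p q :=
      div_nonneg (mul_nonneg hq.1 (by linarith [hp.2])) (sq_nonneg _)
    set y := mrwFluct X (q / (1 - (p - q))) with hy
    have hyb : ∀ k, IsBddMeasurable _ (y k) := fun k =>
      (isBddMeasurable_mrwFluct _ k).mono (hX.mrwPast_le k)
    rw [show 2 * (r + 1) = 2 * r + 2 by ring]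
    refine exists_forall_le_of_le_contraction (c := (r + 1) * (1 - 2 * (p - q))) (C := C)
      (D := (r + 1) * (2 * r + 1) * mrwSigmaSq p q * B + C) (fun k => ?_) ?_ fun k hk => ?_
    · refine integral_nonneg fun ω => ?_
      rw [show 2 * r + 2 = 2 * (r + 1) by ring, pow_mul]
      positivity
    · have : 0 < 1 - 2 * (p - q) := by linarith
      positivity
    · obtain ⟨h1, h2, h3, h4, -, h6⟩ := H k hk
      have hk0 : (0 : ℝ) < k := by positivity
      have hEb := h2.mono (hX.mrwPast_le k)
      have hDb := h4.mono (hX.mrwPast_le (k + 1))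
      have i1 := ((hyb k).pow (2 * r + 2)).integrable (P := P)
      have i2 := (((hyb k).pow (2 * r + 2)).div_const k |> (IsBddMeasurable.const
        ((r + 1) * (1 - 2 * (p - q)))).mul).integrable (P := P)
      have i3 := (((hyb k).pow (2 * r)).div_const k |> (IsBddMeasurable.const
        ((r + 1) * (2 * r + 1) * mrwSigmaSq p q)).mul).integrable (P := P)
      have i12 : Integrable (fun ω => y k ω ^ (2 * r + 2)
          - (r + 1) * (1 - 2 * (p - q)) * (y k ω ^ (2 * r + 2) / k)) P := i1.sub i2
      have i123 : Integrable (fun ω => y k ω ^ (2 * r + 2)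
          - (r + 1) * (1 - 2 * (p - q)) * (y k ω ^ (2 * r + 2) / k)
          + (r + 1) * (2 * r + 1) * mrwSigmaSq p q * (y k ω ^ (2 * r) / k)) P := i12.add i3
      have i1234 : Integrable (fun ω => y k ω ^ (2 * r + 2)
          - (r + 1) * (1 - 2 * (p - q)) * (y k ω ^ (2 * r + 2) / k)
          + (r + 1) * (2 * r + 1) * mrwSigmaSq p q * (y k ω ^ (2 * r) / k) + E k ω) P :=
        i123.add hEb.integrable
      have hD0 : ∫ ω, D k ω ∂P = 0 := by
        simpa using h6 (fun _ => 1) (IsBddMeasurable.const 1)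
      have hE : ∫ ω, E k ω ∂P
          ≤ C * (√(k : ℝ))⁻¹ ^ 3 * (1 + ∫ ω, y k ω ^ (2 * r + 2) ∂P) := by
        calc _ ≤ ∫ ω, C * (√(k : ℝ))⁻¹ ^ 3 * (1 + y k ω ^ (2 * r + 2)) ∂P :=
              integral_mono hEb.integrable ((IsBddMeasurable.const _).mul
                ((IsBddMeasurable.const 1).add ((hyb k).pow _))).integrable
                fun ω => (le_abs_self _).trans (h3 ω)
          _ = _ := by
            rw [integral_const_mul, integral_add (integrable_const _) i1]
            simp
      -- The constant part of the error bound is absorbed into the D/k term of the contraction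
      -- lemma.
      have hτ : (√(k : ℝ))⁻¹ ^ 3 ≤ 1 / k := by
        have h1 : (√(k : ℝ))⁻¹ ≤ 1 :=
          inv_le_one_of_one_le₀ (Real.one_le_sqrt.2 (by exact_mod_cast hk))
        calc (√(k : ℝ))⁻¹ ^ 3 ≤ (√(k : ℝ))⁻¹ ^ 2 :=
              pow_le_pow_of_le_one (by positivity) h1 (by norm_num)
          _ = 1 / k := by rw [inv_pow, Real.sq_sqrt hk0.le, one_div]
      have e : ∫ ω, y (k + 1) ω ^ (2 * r + 2) ∂P
          = ∫ ω, y k ω ^ (2 * r + 2) ∂P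
            - (r + 1) * (1 - 2 * (p - q)) * ((∫ ω, y k ω ^ (2 * r + 2) ∂P) / k)
            + (r + 1) * (2 * r + 1) * mrwSigmaSq p q * ((∫ ω, y k ω ^ (2 * r) ∂P) / k)
            + ∫ ω, E k ω ∂P := by
        rw [integral_congr_ae (ae_of_all _ h1), integral_add i1234 hDb.integrable,
          integral_add i123 hEb.integrable, integral_add i12 i3,
          integral_sub i1 i2, integral_const_mul, integral_const_mul, integral_div, integral_div,
          hD0, add_zero]
      rw [e]
      have hd : (r + 1) * (2 * r + 1) * mrwSigmaSq p q * ((∫ ω, y k ω ^ (2 * r) ∂P) / k)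
          ≤ (r + 1) * (2 * r + 1) * mrwSigmaSq p q * (B / k) := by
        gcongr
        exact hB k
      have hCτ := mul_le_mul_of_nonneg_left hτ hC
      calc _ ≤ ∫ ω, y k ω ^ (2 * r + 2) ∂P
            - (r + 1) * (1 - 2 * (p - q)) * ((∫ ω, y k ω ^ (2 * r + 2) ∂P) / k)
            + (r + 1) * (2 * r + 1) * mrwSigmaSq p q * (B / k)
            + (C * (1 / k) + C * (√(k : ℝ))⁻¹ ^ 3 * ∫ ω, y k ω ^ (2 * r + 2) ∂P) := by
              linarith
        _ = _ := by ring

end IsMinimalRandomWalk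

/-! ### Mean-square estimate for the logarithmic averages -/

/-- Martingale differences are orthogonal. -/
theorem integral_sum_sq_eq_sum_integral_sq {Ω : Type*} {m0 : MeasurableSpace Ω} {P : Measure Ω}
    [IsFiniteMeasure P] {F : ℕ → MeasurableSpace Ω} (hF : Monotone F) (hle : ∀ n, F n ≤ m0)
    {D : ℕ → Ω → ℝ} (hD : ∀ k, 1 ≤ k → IsBddMeasurable (F (k + 1)) (D k))
    (horth : ∀ k, 1 ≤ k → ∀ Y, IsBddMeasurable (F k) Y → ∫ ω, Y ω * D k ω ∂P = 0) (n : ℕ) :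
    ∫ ω, (∑ k ∈ Finset.Icc 1 n, D k ω) ^ 2 ∂P = ∑ k ∈ Finset.Icc 1 n, ∫ ω, D k ω ^ 2 ∂P := by
  induction n with
  | zero => simp
  | succ n ih =>
    have hS : IsBddMeasurable (F (n + 1)) (fun ω => ∑ k ∈ Finset.Icc 1 n, D k ω) :=
      IsBddMeasurable.sum _ fun k hk => by
        rw [Finset.mem_Icc] at hk
        exact (hD k hk.1).mono (hF (by omega))
    have hDn := (hD (n + 1) (by omega)).mono (hle _)
    have hSn := hS.mono (hle _)
    have i1 := (hSn.pow 2).integrable (P := P)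
    have i2 := (((IsBddMeasurable.const 2).mul hSn).mul hDn).integrable (P := P)
    have i3 := (hDn.pow 2).integrable (P := P)
    have i12 : Integrable (fun ω => (∑ k ∈ Finset.Icc 1 n, D k ω) ^ 2
        + 2 * (∑ k ∈ Finset.Icc 1 n, D k ω) * D (n + 1) ω) P := i1.add i2
    simp only [Finset.sum_Icc_succ_top (Nat.le_add_left 1 n), add_sq]
    rw [integral_add i12 i3, integral_add i1 i2, ih,
      horth (n + 1) (by omega) _ ((IsBddMeasurable.const 2).mul hS), add_zero]

theorem summable_inv_sqrt_pow_three : Summable fun k : ℕ => (√(k : ℝ))⁻¹ ^ 3 := by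
  refine (Real.summable_one_div_nat_rpow.2 (by norm_num : (1 : ℝ) < 3 / 2)).congr fun k => ?_
  rw [Real.sqrt_eq_rpow, ← Real.rpow_neg (by positivity), ← Real.rpow_natCast,
    ← Real.rpow_mul (by positivity), one_div, ← Real.rpow_neg (by positivity)]
  norm_num

/-- The almost sure limit of the logarithmic averages of the even powers of the fluctuation. -/
noncomputable def mrwLogLimit (p q : ℝ) (r : ℕ) : ℝ :=
  mrwSigmaSq p q ^ r * (Nat.factorial (2 * r) : ℝ) /
    (2 ^ r * (Nat.factorial r : ℝ) * (1 - 2 * (p - q)) ^ r)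

theorem mrwLogLimit_zero (p q : ℝ) : mrwLogLimit p q 0 = 1 := by simp [mrwLogLimit]

/-- The recurrence of Gaussian even moments, with the coefficients of the two drift terms: in the
limit these terms balance. -/
theorem mrwLogLimit_succ {p q : ℝ} (hα : p - q < 1 / 2) (r : ℕ) :
    (r + 1) * (1 - 2 * (p - q)) * mrwLogLimit p q (r + 1)
      = (r + 1) * (2 * r + 1) * mrwSigmaSq p q * mrwLogLimit p q r := by
  have h : 1 - 2 * (p - q) ≠ 0 := by linarith
  have hr : (r : ℝ) + 1 ≠ 0 := by positivity
  have hf : (Nat.factorial r : ℝ) ≠ 0 := by positivity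
  rw [mrwLogLimit, mrwLogLimit, show 2 * (r + 1) = 2 * r + 1 + 1 by ring, Nat.factorial_succ,
    Nat.factorial_succ, Nat.factorial_succ]
  generalize 1 - 2 * (p - q) = c at h ⊢
  push_cast
  field_simp
  ring

namespace IsMinimalRandomWalk

variable {Ω : Type*} [MeasurableSpace Ω] {P : Measure Ω} [IsProbabilityMeasure P]
  {p q s : ℝ} {X : ℕ → Ω → ℝ} {K : ℕ → Ω → ℕ}

/-- The logarithmic averages of the even powers of the fluctuation are close in mean square to a
multiple of the harmonic numbers. -/
theorem exists_integral_logMoment_sub_sq_le (hX : IsMinimalRandomWalk P p q s X K)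
    (hp : p ∈ Set.Icc (0 : ℝ) 1) (hq : q ∈ Set.Icc (0 : ℝ) 1) (hα : p - q < 1 / 2) (r : ℕ) :
    ∃ C : ℝ, 0 ≤ C ∧ ∀ n, 1 ≤ n →
      ∫ ω, (∑ k ∈ Finset.Icc 1 n, mrwFluct X (q / (1 - (p - q))) k ω ^ (2 * r) / k
        - mrwLogLimit p q r * ∑ k ∈ Finset.Icc 1 n, (k : ℝ)⁻¹) ^ 2 ∂P
      ≤ C * ∑ k ∈ Finset.Icc 1 n, (k : ℝ)⁻¹ := by
  induction r with
  | zero =>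
    refine ⟨0, le_rfl, fun n _ => ?_⟩
    simp [mrwLogLimit_zero]
  | succ r ih =>
    obtain ⟨C₀, hC₀, H₀⟩ := ih
    obtain ⟨C, hC, E, D, H⟩ := hX.exists_fluct_pow_decomposition hp hq (by linarith) r
    -- Second moments of y ^ (2r + 2) are needed, hence the moment of order 2(2r + 2).
    obtain ⟨B, hB0, hB⟩ := hX.exists_integral_fluct_pow_le hp hq hα (2 * r + 2)
    rw [show 2 * (r + 1) = 2 * r + 2 by ring]
    set y := mrwFluct X (q / (1 - (p - q))) with hy
    set c : ℝ := (r + 1) * (1 - 2 * (p - q)) with hc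
    set d : ℝ := (r + 1) * (2 * r + 1) * mrwSigmaSq p q with hd
    set L := mrwLogLimit p q (r + 1) with hL
    set L' := mrwLogLimit p q r with hL'
    have hcL : c * L = d * L' := mrwLogLimit_succ hα r
    have hc0 : 0 < c := by
      have : 0 < 1 - 2 * (p - q) := by linarith
      positivity
    have hyb : ∀ k, IsBddMeasurable ‹MeasurableSpace Ω› (y k) := fun k =>
      (isBddMeasurable_mrwFluct _ k).mono (hX.mrwPast_le k)
    have hEb : ∀ k, 1 ≤ k → IsBddMeasurable ‹MeasurableSpace Ω› (E k) := fun k hk =>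
      (H k hk).2.1.mono (hX.mrwPast_le _)
    have hDb : ∀ k, 1 ≤ k → IsBddMeasurable ‹MeasurableSpace Ω› (D k) := fun k hk =>
      (H k hk).2.2.2.1.mono (hX.mrwPast_le _)
    have hy4 : ∀ k, ∫ ω, (y k ω ^ (2 * r + 2)) ^ 2 ∂P ≤ B := fun k => by
      refine le_trans (le_of_eq ?_) (hB k)
      congr 1
      ext ω
      rw [← pow_mul, mul_comm]
    have hw : ∀ k, ∫ ω, (1 + y k ω ^ (2 * r + 2)) ^ 2 ∂P ≤ 2 + 2 * B := by
      intro k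
      calc _ ≤ ∫ ω, 2 + 2 * (y k ω ^ (2 * r + 2)) ^ 2 ∂P := by
            refine integral_mono ((((IsBddMeasurable.const 1).add ((hyb k).pow _)).pow 2)).integrable
              ((IsBddMeasurable.const 2).add
                ((IsBddMeasurable.const 2).mul (((hyb k).pow _).pow 2))).integrable fun ω => ?_
            dsimp only
            nlinarith [sq_nonneg (1 - y k ω ^ (2 * r + 2))]
        _ = 2 + 2 * ∫ ω, (y k ω ^ (2 * r + 2)) ^ 2 ∂P := by
            rw [integral_add (integrable_const _)
              ((IsBddMeasurable.const 2).mul (((hyb k).pow _).pow 2)).integrable,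
              integral_const_mul]
            simp
        _ ≤ _ := by linarith [hy4 k]
    set T : ℝ := ∑' k : ℕ, (√(k : ℝ))⁻¹ ^ 3 with hT
    have hT0 : 0 ≤ T := tsum_nonneg fun k => by positivity
    have hTn : ∀ n : ℕ, ∑ k ∈ Finset.Icc 1 n, (√(k : ℝ))⁻¹ ^ 3 ≤ T := fun n =>
      summable_inv_sqrt_pow_three.sum_le_tsum _ fun k _ => by positivity
    -- Cauchy–Schwarz with the summable weights k^(-3/2) gives a bound independent of n.
    have hEsq : ∀ n : ℕ, ∫ ω, (∑ k ∈ Finset.Icc 1 n, E k ω) ^ 2 ∂P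
        ≤ C ^ 2 * T ^ 2 * (2 + 2 * B) := by
      intro n
      have hpt : ∀ ω, (∑ k ∈ Finset.Icc 1 n, E k ω) ^ 2
          ≤ C ^ 2 * T * ∑ k ∈ Finset.Icc 1 n,
            (√(k : ℝ))⁻¹ ^ 3 * (1 + y k ω ^ (2 * r + 2)) ^ 2 := by
        intro ω
        have h1 : |∑ k ∈ Finset.Icc 1 n, E k ω|
            ≤ C * ∑ k ∈ Finset.Icc 1 n, (√(k : ℝ))⁻¹ ^ 3 * (1 + y k ω ^ (2 * r + 2)) := by
          rw [Finset.mul_sum]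
          refine (Finset.abs_sum_le_sum_abs _ _).trans (Finset.sum_le_sum fun k hk => ?_)
          rw [← mul_assoc]
          exact (H k (Finset.mem_Icc.1 hk).1).2.2.1 ω
        have h2 := Finset.sum_sq_le_sum_mul_sum_of_sq_le_mul (Finset.Icc 1 n)
          (r := fun k : ℕ => (√(k : ℝ))⁻¹ ^ 3 * (1 + y k ω ^ (2 * r + 2)))
          (f := fun k : ℕ => (√(k : ℝ))⁻¹ ^ 3)
          (g := fun k : ℕ => (√(k : ℝ))⁻¹ ^ 3 * (1 + y k ω ^ (2 * r + 2)) ^ 2)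
          (fun k _ => by positivity) (fun k _ => by positivity) (fun k _ => le_of_eq (by ring))
        calc _ = |∑ k ∈ Finset.Icc 1 n, E k ω| ^ 2 := (sq_abs _).symm
          _ ≤ (C * ∑ k ∈ Finset.Icc 1 n, (√(k : ℝ))⁻¹ ^ 3 * (1 + y k ω ^ (2 * r + 2))) ^ 2 := by
            gcongr
          _ = C ^ 2 * (∑ k ∈ Finset.Icc 1 n,
              (√(k : ℝ))⁻¹ ^ 3 * (1 + y k ω ^ (2 * r + 2))) ^ 2 := by ring
          _ ≤ C ^ 2 * (T * ∑ k ∈ Finset.Icc 1 n,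
              (√(k : ℝ))⁻¹ ^ 3 * (1 + y k ω ^ (2 * r + 2)) ^ 2) := by
            refine mul_le_mul_of_nonneg_left (h2.trans ?_) (sq_nonneg C)
            exact mul_le_mul_of_nonneg_right (hTn n) (Finset.sum_nonneg fun k _ => by positivity)
          _ = _ := by ring
      have hb : ∀ k : ℕ, IsBddMeasurable ‹MeasurableSpace Ω›
          fun ω => (√(k : ℝ))⁻¹ ^ 3 * (1 + y k ω ^ (2 * r + 2)) ^ 2 := fun k =>
        (IsBddMeasurable.const _).mul (((IsBddMeasurable.const 1).add ((hyb k).pow _)).pow 2)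
      calc _ ≤ _ := integral_mono (((IsBddMeasurable.sum _ fun k hk =>
                hEb k (Finset.mem_Icc.1 hk).1).pow 2).integrable)
              (((IsBddMeasurable.const _).mul (IsBddMeasurable.sum _ fun k _ => hb k)).integrable)
              hpt
        _ = C ^ 2 * T * ∑ k ∈ Finset.Icc 1 n,
            (√(k : ℝ))⁻¹ ^ 3 * ∫ ω, (1 + y k ω ^ (2 * r + 2)) ^ 2 ∂P := by
          rw [integral_const_mul, integral_finsetSum _ fun k _ => (hb k).integrable]
          simp only [integral_const_mul]
        _ ≤ C ^ 2 * T * ∑ k ∈ Finset.Icc 1 n, (√(k : ℝ))⁻¹ ^ 3 * (2 + 2 * B) := by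
          gcongr with k _
          exact hw k
        _ ≤ C ^ 2 * T * (T * (2 + 2 * B)) := by
          rw [← Finset.sum_mul]
          gcongr
          exact hTn n
        _ = _ := by ring
    -- Orthogonality leaves only the diagonal terms, each O(1/k).
    have hDsq : ∀ n : ℕ, ∫ ω, (∑ k ∈ Finset.Icc 1 n, D k ω) ^ 2 ∂P
        ≤ C ^ 2 * (2 + 2 * B) * ∑ k ∈ Finset.Icc 1 n, (k : ℝ)⁻¹ := by
      intro n
      rw [integral_sum_sq_eq_sum_integral_sq mrwPast_mono hX.mrwPast_le
        (fun k hk => (H k hk).2.2.2.1) (fun k hk => (H k hk).2.2.2.2.2), Finset.mul_sum]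
      refine Finset.sum_le_sum fun k hk => ?_
      have hk1 := (Finset.mem_Icc.1 hk).1
      calc _ ≤ ∫ ω, C ^ 2 * (k : ℝ)⁻¹ * (1 + y k ω ^ (2 * r + 2)) ^ 2 ∂P := by
            refine integral_mono ((hDb k hk1).pow 2).integrable ((IsBddMeasurable.const _).mul
              (((IsBddMeasurable.const 1).add ((hyb k).pow _)).pow 2)).integrable fun ω => ?_
            have h1 := (H k hk1).2.2.2.2.1 ω
            calc D k ω ^ 2 = |D k ω| ^ 2 := (sq_abs _).symm
              _ ≤ (C * (√(k : ℝ))⁻¹ * (1 + y k ω ^ (2 * r + 2))) ^ 2 := by gcongr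
              _ = C ^ 2 * (√(k : ℝ) ^ 2)⁻¹ * (1 + y k ω ^ (2 * r + 2)) ^ 2 := by ring
              _ = _ := by rw [Real.sq_sqrt (by positivity)]
        _ = C ^ 2 * (k : ℝ)⁻¹ * ∫ ω, (1 + y k ω ^ (2 * r + 2)) ^ 2 ∂P := integral_const_mul _ _
        _ ≤ C ^ 2 * (k : ℝ)⁻¹ * (2 + 2 * B) := by
          gcongr
          exact hw k
        _ = _ := by ring
    -- The 5 comes from (x₁ + ⋯ + x₅)² ≤ 5 ∑ xᵢ², and 2B from the two boundary terms of the
    -- telescoping sum. The bounds free of n are absorbed using h ≥ 1.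
    refine ⟨5 * (d ^ 2 * C₀ + C ^ 2 * T ^ 2 * (2 + 2 * B) + C ^ 2 * (2 + 2 * B) + 2 * B) / c ^ 2,
      by positivity, fun n hn => ?_⟩
    set h := ∑ k ∈ Finset.Icc 1 n, (k : ℝ)⁻¹ with hh
    have hh1 : 1 ≤ h := by
      have := Finset.single_le_sum (f := fun k : ℕ => (k : ℝ)⁻¹) (fun k _ => by positivity)
        (Finset.mem_Icc.2 ⟨le_rfl, hn⟩)
      simpa using this
    set U : Ω → ℝ := fun ω => ∑ k ∈ Finset.Icc 1 n, y k ω ^ (2 * r + 2) / k - L * h with hU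
    set V : Ω → ℝ := fun ω => ∑ k ∈ Finset.Icc 1 n, y k ω ^ (2 * r) / k - L' * h with hV
    have hUb : IsBddMeasurable ‹MeasurableSpace Ω› U :=
      (IsBddMeasurable.sum _ fun k _ => ((hyb k).pow _).div_const _).sub (IsBddMeasurable.const _)
    have hVb : IsBddMeasurable ‹MeasurableSpace Ω› V :=
      (IsBddMeasurable.sum _ fun k _ => ((hyb k).pow _).div_const _).sub (IsBddMeasurable.const _)
    have hES : IsBddMeasurable ‹MeasurableSpace Ω› (fun ω => ∑ k ∈ Finset.Icc 1 n, E k ω) :=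
      IsBddMeasurable.sum _ fun k hk => hEb k (Finset.mem_Icc.1 hk).1
    have hDS : IsBddMeasurable ‹MeasurableSpace Ω› (fun ω => ∑ k ∈ Finset.Icc 1 n, D k ω) :=
      IsBddMeasurable.sum _ fun k hk => hDb k (Finset.mem_Icc.1 hk).1
    -- Telescoped decomposition; the multiples of the harmonic number h cancel because c L = d L'.
    have htel : ∀ ω, c * U ω = d * V ω + ∑ k ∈ Finset.Icc 1 n, E k ω
        + ∑ k ∈ Finset.Icc 1 n, D k ω - y (n + 1) ω ^ (2 * r + 2) + y 1 ω ^ (2 * r + 2) := by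
      intro ω
      have h1 : ∑ k ∈ Finset.Icc 1 n, (y (k + 1) ω ^ (2 * r + 2) - y k ω ^ (2 * r + 2))
          = y (n + 1) ω ^ (2 * r + 2) - y 1 ω ^ (2 * r + 2) := by
        clear_value y
        clear hUb hVb hES hDS hU hV U V hh hh1 h
        induction n, hn using Nat.le_induction with
        | base => simp
        | succ n hn ih =>
          rw [Finset.sum_Icc_succ_top (by omega), ih]
          ring
      have h2 : ∑ k ∈ Finset.Icc 1 n, (y (k + 1) ω ^ (2 * r + 2) - y k ω ^ (2 * r + 2))
          = -c * ∑ k ∈ Finset.Icc 1 n, y k ω ^ (2 * r + 2) / k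
            + d * ∑ k ∈ Finset.Icc 1 n, y k ω ^ (2 * r) / k
            + ∑ k ∈ Finset.Icc 1 n, E k ω + ∑ k ∈ Finset.Icc 1 n, D k ω := by
        rw [Finset.mul_sum, Finset.mul_sum, ← Finset.sum_add_distrib, ← Finset.sum_add_distrib,
          ← Finset.sum_add_distrib]
        refine Finset.sum_congr rfl fun k hk => ?_
        rw [(H k (Finset.mem_Icc.1 hk).1).1 ω]
        ring
      simp only [hU, hV]
      linear_combination h2 - h1 - h * hcL
    have hpt : ∀ ω, c ^ 2 * U ω ^ 2 ≤ 5 * d ^ 2 * V ω ^ 2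
        + 5 * (∑ k ∈ Finset.Icc 1 n, E k ω) ^ 2 + 5 * (∑ k ∈ Finset.Icc 1 n, D k ω) ^ 2
        + 5 * (y (n + 1) ω ^ (2 * r + 2)) ^ 2 + 5 * (y 1 ω ^ (2 * r + 2)) ^ 2 := by
      intro ω
      rw [← mul_pow, htel ω]
      generalize (∑ k ∈ Finset.Icc 1 n, E k ω) = x₂
      generalize (∑ k ∈ Finset.Icc 1 n, D k ω) = x₃
      generalize y (n + 1) ω ^ (2 * r + 2) = x₄
      generalize y 1 ω ^ (2 * r + 2) = x₅
      rw [mul_assoc 5, ← mul_pow]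
      generalize d * V ω = x₁
      -- 5 ∑ xᵢ² minus the square of the sum is the sum of the squared pairwise differences; x₄
      -- enters with a minus sign.
      linarith [sq_nonneg (x₁ - x₂), sq_nonneg (x₁ - x₃), sq_nonneg (x₁ + x₄),
        sq_nonneg (x₁ - x₅), sq_nonneg (x₂ - x₃), sq_nonneg (x₂ + x₄), sq_nonneg (x₂ - x₅),
        sq_nonneg (x₃ + x₄), sq_nonneg (x₃ - x₅), sq_nonneg (x₄ + x₅)]
    have b1 := (IsBddMeasurable.const (5 * d ^ 2)).mul (hVb.pow 2)
    have b2 := (IsBddMeasurable.const 5).mul (hES.pow 2)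
    have b3 := (IsBddMeasurable.const 5).mul (hDS.pow 2)
    have b4 := (IsBddMeasurable.const 5).mul (((hyb (n + 1)).pow (2 * r + 2)).pow 2)
    have b5 := (IsBddMeasurable.const 5).mul (((hyb 1).pow (2 * r + 2)).pow 2)
    have hint : c ^ 2 * ∫ ω, U ω ^ 2 ∂P ≤ 5 * d ^ 2 * ∫ ω, V ω ^ 2 ∂P
        + 5 * ∫ ω, (∑ k ∈ Finset.Icc 1 n, E k ω) ^ 2 ∂P
        + 5 * ∫ ω, (∑ k ∈ Finset.Icc 1 n, D k ω) ^ 2 ∂P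
        + 5 * ∫ ω, (y (n + 1) ω ^ (2 * r + 2)) ^ 2 ∂P
        + 5 * ∫ ω, (y 1 ω ^ (2 * r + 2)) ^ 2 ∂P := by
      rw [← integral_const_mul]
      refine (integral_mono ((IsBddMeasurable.const (c ^ 2)).mul (hUb.pow 2)).integrable
        ((((b1.add b2).add b3).add b4).add b5).integrable hpt).trans_eq ?_
      rw [integral_add (((b1.add b2).add b3).add b4).integrable b5.integrable,
        integral_add ((b1.add b2).add b3).integrable b4.integrable,
        integral_add (b1.add b2).integrable b3.integrable,
        integral_add b1.integrable b2.integrable]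
      simp only [integral_const_mul]
    have hfin : c ^ 2 * ∫ ω, U ω ^ 2 ∂P ≤ 5 * (d ^ 2 * C₀ + C ^ 2 * T ^ 2 * (2 + 2 * B)
        + C ^ 2 * (2 + 2 * B) + 2 * B) * h := by
      have j1 := mul_le_mul_of_nonneg_left (H₀ n hn) (sq_nonneg d)
      have j2 := hEsq n
      have j3 := hDsq n
      have j4 := hy4 (n + 1)
      have j5 := hy4 1
      have j6 : C ^ 2 * T ^ 2 * (2 + 2 * B) ≤ C ^ 2 * T ^ 2 * (2 + 2 * B) * h :=
        le_mul_of_one_le_right (by positivity) hh1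
      have j7 : B ≤ B * h := le_mul_of_one_le_right hB0 hh1
      linarith
    rw [div_mul_eq_mul_div, le_div_iff₀ (by positivity), mul_comm]
    exact hfin

end IsMinimalRandomWalk

/-! ### From mean-square bounds to almost sure limits -/

/-- By Tonelli the series ∑ f j has finite integral, so it converges almost everywhere and its terms
tend to 0. -/
theorem ae_tendsto_zero_of_summable_integral {Ω : Type*} {m0 : MeasurableSpace Ω} {P : Measure Ω}
    {f : ℕ → Ω → ℝ} (hf : ∀ j, Integrable (f j) P) (h0 : ∀ j ω, 0 ≤ f j ω)
    (hs : Summable fun j => ∫ ω, f j ω ∂P) :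
    ∀ᵐ ω ∂P, Tendsto (fun j => f j ω) atTop (𝓝 0) := by
  have hm : ∀ j, AEMeasurable (fun ω => ENNReal.ofReal (f j ω)) P := fun j =>
    (hf j).aestronglyMeasurable.aemeasurable.ennreal_ofReal
  have hfin : ∫⁻ ω, ∑' j, ENNReal.ofReal (f j ω) ∂P ≠ ⊤ := by
    rw [lintegral_tsum hm]
    simp only [← ofReal_integral_eq_lintegral_ofReal (hf _) (ae_of_all _ (h0 _))]
    exact hs.tsum_ofReal_ne_top
  filter_upwards [ae_lt_top' (AEMeasurable.tsum hm) hfin] with ω hω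
  have h1 := ENNReal.tendsto_atTop_zero_of_tsum_ne_top hω.ne
  have h2 := (ENNReal.tendsto_toReal ENNReal.zero_ne_top).comp h1
  simpa [Function.comp_def, ENNReal.toReal_ofReal (h0 _ ω)] using h2

/-- A monotone sequence with linear growth along the powers of two grows logarithmically. -/
theorem tendsto_div_log_of_monotone {A : ℕ → ℝ} (hA : Monotone A) (h0 : ∀ n, 0 ≤ A n) {l : ℝ}
    (h : Tendsto (fun m : ℕ => A (2 ^ m) / m) atTop (𝓝 (l * Real.log 2))) :
    Tendsto (fun n : ℕ => A n / Real.log n) atTop (𝓝 l) := by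
  have hl2 : 0 < Real.log 2 := Real.log_pos (by norm_num)
  have hlog : Tendsto (Nat.log 2) atTop atTop := tendsto_atTop_atTop.2 fun b =>
    ⟨2 ^ b, fun n hn => Nat.le_log_of_pow_le (by norm_num) hn⟩
  have hfrac : Tendsto (fun m : ℕ => (m : ℝ) / (m + 1)) atTop (𝓝 1) := tendsto_natCast_div_add_atTop 1
  have hlow : Tendsto (fun m : ℕ => A (2 ^ m) / m * (m / (m + 1)) / Real.log 2) atTop (𝓝 l) := by
    have := (h.mul hfrac).div_const (Real.log 2)
    rwa [mul_one, mul_div_cancel_right₀ _ hl2.ne'] at this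
  have hup : Tendsto (fun m : ℕ => A (2 ^ (m + 1)) / ((m + 1 : ℕ) : ℝ) / (m / (m + 1)) / Real.log 2)
      atTop (𝓝 l) := by
    have := ((h.comp (tendsto_add_atTop_nat 1)).div hfrac one_ne_zero).div_const (Real.log 2)
    rwa [div_one, mul_div_cancel_right₀ _ hl2.ne'] at this
  refine tendsto_of_tendsto_of_tendsto_of_le_of_le' (hlow.comp hlog) (hup.comp hlog) ?_ ?_
  all_goals
    filter_upwards [eventually_ge_atTop 2] with n hn
    simp only [Function.comp_apply]
    set m := Nat.log 2 n with hm
    have hm1 : 1 ≤ m := Nat.log_pos (by norm_num) hn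
    have hm0 : (0 : ℝ) < m := by positivity
    have hn0 : (0 : ℝ) < n := by positivity
    have l1 : 2 ^ m ≤ n := Nat.pow_log_le_self 2 (by omega)
    have l2 : n ≤ 2 ^ (m + 1) := (Nat.lt_pow_succ_log_self (by norm_num) n).le
    have e1 : m * Real.log 2 ≤ Real.log n := by
      rw [← Real.log_pow]
      exact Real.log_le_log (by positivity) (by exact_mod_cast l1)
    have e2 : Real.log n ≤ (m + 1) * Real.log 2 := by
      have : ((m : ℝ) + 1) * Real.log 2 = ((m + 1 : ℕ) : ℝ) * Real.log 2 := by push_cast; ring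
      rw [this, ← Real.log_pow]
      exact Real.log_le_log hn0 (by exact_mod_cast l2)
    have hpos : 0 < Real.log n := lt_of_lt_of_le (by positivity) e1
  · calc _ = A (2 ^ m) / ((m + 1) * Real.log 2) := by field_simp
      _ ≤ A n / Real.log n := div_le_div₀ (h0 n) (hA l1) hpos e2
  · calc A n / Real.log n ≤ A (2 ^ (m + 1)) / (m * Real.log 2) :=
          div_le_div₀ (h0 _) (hA l2) (by positivity) e1
      _ = _ := by push_cast; field_simp

theorem sum_inv_two_pow_bounds (m : ℕ) :
    m * Real.log 2 ≤ ∑ k ∈ Finset.Icc 1 (2 ^ m : ℕ), (k : ℝ)⁻¹ ∧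
      ∑ k ∈ Finset.Icc 1 (2 ^ m : ℕ), (k : ℝ)⁻¹ ≤ 1 + m * Real.log 2 := by
  have e : ((harmonic (2 ^ m) : ℚ) : ℝ) = ∑ k ∈ Finset.Icc 1 (2 ^ m : ℕ), (k : ℝ)⁻¹ := by
    rw [harmonic_eq_sum_Icc]
    push_cast
    rfl
  have h1 := log_add_one_le_harmonic (2 ^ m)
  have h2 := harmonic_le_one_add_log (2 ^ m)
  rw [e] at h1 h2
  push_cast at h1 h2
  rw [Real.log_pow] at h2
  refine ⟨le_trans ?_ h1, h2⟩
  rw [← Real.log_pow]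
  exact Real.log_le_log (by positivity) (by linarith)

/-- Mean square closeness to a multiple of the harmonic numbers gives almost sure logarithmic
growth, for monotone sequences. -/
theorem ae_tendsto_div_log_of_integral_sq_le {Ω : Type*} {m0 : MeasurableSpace Ω} {P : Measure Ω}
    [IsFiniteMeasure P] {A : ℕ → Ω → ℝ} {l C : ℝ} (hb : ∀ n, IsBddMeasurable m0 (A n))
    (h0 : ∀ n ω, 0 ≤ A n ω) (hmono : ∀ ω, Monotone fun n => A n ω) (hC : 0 ≤ C)
    (h : ∀ n, 1 ≤ n → ∫ ω, (A n ω - l * ∑ k ∈ Finset.Icc 1 n, (k : ℝ)⁻¹) ^ 2 ∂P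
      ≤ C * ∑ k ∈ Finset.Icc 1 n, (k : ℝ)⁻¹) :
    ∀ᵐ ω ∂P, Tendsto (fun n : ℕ => A n ω / Real.log n) atTop (𝓝 l) := by
  have hl2 : 0 < Real.log 2 := Real.log_pos (by norm_num)
  have hl2' : Real.log 2 ≤ 1 := by linarith [Real.log_le_sub_one_of_pos (zero_lt_two' ℝ)]
  -- At time 2 ^ c j the mean square is O(c j); dividing by (c j)² leaves the summable O(1/(j +
  -- 1)²). At the same time c (j + 1) / c j → 1, which lets monotonicity fill the gaps.
  let c : ℕ → ℕ := fun j => (j + 1) ^ 2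
  have hc0 : ∀ j, (0 : ℝ) < c j := fun j => by positivity
  have hc1 : ∀ j, (1 : ℝ) ≤ c j := fun j => by exact_mod_cast Nat.one_le_pow _ _ (by omega)
  have hct : Tendsto c atTop atTop :=
    (tendsto_pow_atTop two_ne_zero).comp (tendsto_add_atTop_nat 1)
  let f : ℕ → Ω → ℝ := fun j ω =>
    ((A (2 ^ c j) ω - l * ∑ k ∈ Finset.Icc 1 (2 ^ c j : ℕ), (k : ℝ)⁻¹) / c j) ^ 2
  have hf : ∀ j, Integrable (f j) P := fun j =>
    ((((hb _).sub (IsBddMeasurable.const _)).div_const _).pow 2).integrable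
  have hfle : ∀ j, ∫ ω, f j ω ∂P ≤ 2 * C * (1 / ((j + 1 : ℕ) : ℝ) ^ 2) := by
    intro j
    have h1 := h (2 ^ c j) (Nat.one_le_two_pow)
    have h2 := (sum_inv_two_pow_bounds (c j)).2
    have h3 : (c j : ℝ) * Real.log 2 ≤ c j := mul_le_of_le_one_right (hc0 j).le hl2'
    simp only [f, div_pow, integral_div]
    rw [div_le_iff₀ (by have := hc0 j; positivity)]
    calc _ ≤ _ := h1
      _ ≤ C * (2 * c j) := by
        gcongr
        linarith [hc1 j]
      _ = _ := by
        simp only [c]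
        push_cast
        field_simp
  have hsum : Summable fun j => ∫ ω, f j ω ∂P := by
    refine Summable.of_nonneg_of_le (fun j => integral_nonneg fun ω => sq_nonneg _) hfle ?_
    exact ((summable_nat_add_iff 1).2
      (Real.summable_one_div_nat_pow.2 one_lt_two)).mul_left (2 * C)
  have hharm : Tendsto (fun j => (∑ k ∈ Finset.Icc 1 (2 ^ c j : ℕ), (k : ℝ)⁻¹) / c j) atTop
      (𝓝 (Real.log 2)) := by
    have hinv : Tendsto (fun j => ((c j : ℝ))⁻¹) atTop (𝓝 0) :=
      tendsto_inv_atTop_zero.comp (tendsto_natCast_atTop_atTop.comp hct)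
    have hu : Tendsto (fun j => ((c j : ℝ))⁻¹ + Real.log 2) atTop (𝓝 (Real.log 2)) := by
      simpa using hinv.add_const (Real.log 2)
    refine tendsto_of_tendsto_of_tendsto_of_le_of_le tendsto_const_nhds hu (fun j => ?_)
      fun j => ?_
    · rw [le_div_iff₀ (hc0 j), mul_comm]
      exact (sum_inv_two_pow_bounds (c j)).1
    · rw [div_le_iff₀ (hc0 j), add_mul, inv_mul_cancel₀ (hc0 j).ne', mul_comm (Real.log 2)]
      exact (sum_inv_two_pow_bounds (c j)).2
  filter_upwards [ae_tendsto_zero_of_summable_integral hf (fun j ω => sq_nonneg _) hsum]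
    with ω hω
  refine tendsto_div_log_of_monotone (hmono ω) (fun n => h0 n ω) ?_
  refine tendsto_div_of_monotone_of_exists_subseq_tendsto_div (fun m => A (2 ^ m) ω) _
    (fun i j hij => hmono ω (Nat.pow_le_pow_right (by norm_num) hij)) fun a ha => ?_
  refine ⟨c, ?_, hct, ?_⟩
  · have t1 : Tendsto (fun j : ℕ => (1 + 1 / ((j : ℝ) + 1)) ^ 2) atTop (𝓝 ((1 + 0) ^ 2)) :=
      (tendsto_one_div_add_atTop_nhds_zero_nat.const_add 1).pow 2
    rw [add_zero, one_pow] at t1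
    filter_upwards [t1.eventually_le_const ha] with j hj
    have e : (c (j + 1) : ℝ) = (1 + 1 / ((j : ℝ) + 1)) ^ 2 * c j := by
      simp only [c]
      push_cast
      field_simp
    rw [e]
    gcongr
  · have h1 : Tendsto (fun j => (A (2 ^ c j) ω
        - l * ∑ k ∈ Finset.Icc 1 (2 ^ c j : ℕ), (k : ℝ)⁻¹) / c j) atTop (𝓝 0) := by
      have := hω.sqrt
      simp only [f, Real.sqrt_sq_eq_abs, Real.sqrt_zero] at this
      exact (tendsto_zero_iff_abs_tendsto_zero _).2 this
    have h2 := h1.add (hharm.const_mul l)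
    rw [zero_add] at h2
    refine h2.congr fun j => ?_
    ring

theorem theorem2 {Ω : Type*} [MeasurableSpace Ω] (P : Measure Ω) [IsProbabilityMeasure P]
    (p q s α : ℝ) (hp : p ∈ Set.Icc (0 : ℝ) 1) (hq : q ∈ Set.Ioc (0 : ℝ) 1)
    (hs : s ∈ Set.Ioo (0 : ℝ) 1) (hα : α = p - q) (hdiff : α < 1 / 2)
    (X : ℕ → Ω → ℝ) (K : ℕ → Ω → ℕ) (hX : IsMinimalRandomWalk P p q s X K)
    (r : ℕ) (hr : 1 ≤ r) :
    ∀ᵐ ω ∂P, Tendsto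
      (fun n : ℕ => 1 / Real.log (n : ℝ) *
        ∑ k ∈ Finset.Icc 1 n,
          (k : ℝ) ^ (r - 1) * (mrwPosition X k ω / (k : ℝ) - q / (1 - α)) ^ (2 * r))
      atTop
      (𝓝 (mrwSigmaSq p q ^ r * (Nat.factorial (2 * r) : ℝ) /
        (2 ^ r * (Nat.factorial r : ℝ) * (1 - 2 * α) ^ r))) := by
  subst hα
  have hq' : q ∈ Set.Icc (0 : ℝ) 1 := ⟨hq.1.le, hq.2⟩
  obtain ⟨C, hC, H⟩ := hX.exists_integral_logMoment_sub_sq_le hp hq' hdiff r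
  set μ := q / (1 - (p - q)) with hμ
  have hterm : ∀ (k : ℕ) ω, 0 ≤ mrwFluct X μ k ω ^ (2 * r) / k := fun k ω => by
    rw [pow_mul]
    positivity
  have hlim := ae_tendsto_div_log_of_integral_sq_le
    (A := fun n ω => ∑ k ∈ Finset.Icc 1 n, mrwFluct X μ k ω ^ (2 * r) / k)
    (fun n => IsBddMeasurable.sum _ fun k _ =>
      (((isBddMeasurable_mrwFluct μ k).mono (hX.mrwPast_le k)).pow _).div_const _)
    (fun n ω => Finset.sum_nonneg fun k _ => hterm k ω)
    (fun ω i j hij => Finset.sum_le_sum_of_subset_of_nonneg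
      (Finset.Icc_subset_Icc_right hij) fun k _ _ => hterm k ω) hC H
  filter_upwards [hlim, hX.mrwPosition_eq_mrwCount] with ω hω hpos
  refine hω.congr fun n => ?_
  rw [one_div, div_eq_inv_mul]
  congr 1
  refine Finset.sum_congr rfl fun k hk => ?_
  have hk0 : (0 : ℝ) < k := by exact_mod_cast (Finset.mem_Icc.1 hk).1
  -- The summands agree since y_k^(2r)/k = k^(r-1) (S_k/k - μ)^(2r); writing r as a successor
  -- removes the truncated subtraction.
  obtain ⟨r, rfl⟩ := Nat.exists_eq_add_of_le' hr
  rw [hpos, mrwFluct, div_pow, pow_mul √(k : ℝ), Real.sq_sqrt hk0.le, Nat.add_sub_cancel,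
    show mrwCount X k ω / k - μ = (mrwCount X k ω - k * μ) / k by field_simp, div_pow]
  field_simp
  ring
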